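/- Let $N=(N_t)_{t\ge0}$ be a Poisson process with intensity $\lambda>0$, and let $Z_1,Z_2,\dots$ be i.i.d. random variables with values in $\{0,1,2,\dots\}$, independent of $N$, with $\mathsf P\{Z_1\ge1\}>0$. Put $S_t=\sum_{i=1}^{N_t}Z_i$ for $t\ge0$ (an integer-valued subordinator without drift), let $q\in(0,1)$, and let $I_q=\int_0^\infty q^{S_t}\,\mathrm dt$. Define real numbers $c_j$, $j\ge0$, by $$c_0=1,\qquad c_j=\frac{1}{(1-q^{-j})\,\mathsf P\{Z_1\ge1\}}\sum_{k=1}^{j}q^{-k}\,\mathsf P\{Z_1=k\}\,c_{j-k},\quad j\ge1.$$ Then $I_q$ is ($\mathsf P$-almost surely equal to) a random variable, the series $\sum_{j=0}^\infty c_jq^j$ converges absolutely and its sum is not zero, and for every $x>0$ $$\mathsf P\{I_q\le x\}=1-\frac{1}{\sum_{j=0}^{\infty}c_jq^j}\sum_{j=0}^{\infty}c_jq^j\exp\bigl(-\lambda\,\mathsf P\{Z_1\ge1\}\,q^{-j}x\bigr),$$ where the series on the right converges absolutely. -/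

import Mathlib

open MeasureTheory ProbabilityTheory Set
open scoped NNReal ENNReal

namespace IVS

/-- `N` is a (homogeneous) Poisson process with intensity `lam` under `P`: it starts from `0`, has
independent increments, its increments over `[s, t]` are Poisson distributed with parameter
`lam * (t - s)`, and almost all of its paths are nondecreasing and right-continuous
(`ℕ` carries the discrete topology, so such paths are càdlàg step functions). -/
structure IsPoissonProcess {Ω : Type*} [MeasurableSpace Ω] (P : Measure Ω) (lam : ℝ≥0)
    (N : ℝ≥0 → Ω → ℕ) : Prop where
  measurable : ∀ t, Measurable (N t)
  zero : ∀ᵐ ω ∂P, N 0 ω = 0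
  indep_increments : HasIndepIncrements N P
  law_increments : ∀ s t : ℝ≥0, s ≤ t →
    P.map (fun ω => N t ω - N s ω) = poissonMeasure (lam * (t - s))
  paths : ∀ᵐ ω ∂P, Monotone (fun t => N t ω) ∧
    ∀ t, ContinuousWithinAt (fun t => N t ω) (Ici t) t

/-- The process `S_t = Z_1 + ⋯ + Z_{N_t}`. The jump sizes are indexed from `0`, so that `Z i`
is the jump size usually called `Z_{i+1}`. -/
def compoundSum {Ω : Type*} (N : ℝ≥0 → Ω → ℕ) (Z : ℕ → Ω → ℕ) (t : ℝ≥0) (ω : Ω) : ℕ :=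
  ∑ i ∈ Finset.range (N t ω), Z i ω

/-- The exponential functional `∫_0^∞ q ^ (S_t + μ t) dt` of `S` with drift `μ`, as an extended
nonnegative number. -/
noncomputable def expFunctional {Ω : Type*} (q μ : ℝ) (S : ℝ≥0 → Ω → ℕ) (ω : Ω) : ℝ≥0∞ :=
  ∫⁻ t in Ioi (0 : ℝ), ENNReal.ofReal (q ^ ((S t.toNNReal ω : ℝ) + μ * t))

/-- The coefficients `c_j`; here `Z₁` is a random variable with the law of the jump sizes. The
recurrence is restated with the usual indexing in `coeff_zero` and `coeff_eq`. -/
noncomputable def coeff {Ω : Type*} [MeasurableSpace Ω] (P : Measure Ω) (Z₁ : Ω → ℕ) (q : ℝ) :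
    ℕ → ℝ
  | 0 => 1
  | j + 1 => 1 / ((1 - q ^ (-((j + 1 : ℕ) : ℤ))) * P.real {ω | 1 ≤ Z₁ ω}) *
      ∑ k : Fin (j + 1), q ^ (-((k.1 + 1 : ℕ) : ℤ)) * P.real {ω | Z₁ ω = k.1 + 1} *
        coeff P Z₁ q (j - k.1)

theorem coeff_zero {Ω : Type*} [MeasurableSpace Ω] (P : Measure Ω) (Z₁ : Ω → ℕ) (q : ℝ) :
    coeff P Z₁ q 0 = 1 := by
  rw [coeff]

theorem coeff_eq {Ω : Type*} [MeasurableSpace Ω] (P : Measure Ω) (Z₁ : Ω → ℕ) (q : ℝ)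
    (j : ℕ) (hj : 1 ≤ j) :
    coeff P Z₁ q j = 1 / ((1 - q ^ (-(j : ℤ))) * P.real {ω | 1 ≤ Z₁ ω}) *
      ∑ k ∈ Finset.Icc 1 j, q ^ (-(k : ℤ)) * P.real {ω | Z₁ ω = k} * coeff P Z₁ q (j - k) := by
  obtain ⟨j, rfl⟩ : ∃ i, j = i + 1 := ⟨j - 1, by omega⟩
  rw [coeff]
  congr 1
  rw [Fin.sum_univ_eq_sum_range
    (fun k => q ^ (-((k + 1 : ℕ) : ℤ)) * P.real {ω | Z₁ ω = k + 1} * coeff P Z₁ q (j - k)),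
    ← Finset.Ico_add_one_right_eq_Icc, Finset.sum_Ico_eq_sum_range]
  refine Finset.sum_congr rfl fun k _ => ?_
  rw [Nat.add_comm 1 k, Nat.add_sub_add_right]

end IVS

/-! The law of `I_q` is identified through its moments. Write `p = P{Z ≥ 1}`, `d_j = c_j q^j`, `D =
∑ d_j`, and let `a_k` be the law of `Z` with the atom at `0` removed.

On the probabilistic side, the `n`-th power of `∫ q^{S_s} ds` is `n!` times an integral over ordered
times `s₁ < ⋯ < sₙ`. Stationary independent increments then give `E I_q^n = n! / (b_1 ⋯ b_n)`, where
`b_k = λ (1 - E q^{kZ})` (`lintegral_tail_pow`).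

On the analytic side, the recurrence for `c_j` says that `d(x) = ∑ d_j x^j` satisfies `p d(x) = (p -
a(qx)) d(qx)`, with `a(x) = ∑ a_k x^k`. Since `λ (p - a(q^k)) = b_k`, iterating from `x = 1` yields
`D E I_q^n = n! (λp)^{-n} ∑ d_j q^{nj}` (`generating_eq_prod`). The right side is the `n`-th moment
of the signed mixture of exponential laws of rates `λ p q^{-j}` with weights `d_j`.

Growth of order `n! R^n` makes moments determine a finite measure on the half-line
(`measure_eq_of_moments_eq`). The weights may have either sign, so the negative part of the mixture
is moved to the side of `D • law(I_q)` before this is applied (`mul_tail_eq_of_moments`). Comparing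
tails and dividing by `D > 0` gives the formula. -/

namespace IVS

/-! ### The recurrence and its generating function. -/

section Recurrence

variable {a d : ℕ → ℝ} {p q : ℝ}

/-- Since `a 0 = 0`, the sum on the right involves only earlier terms, with nonnegative weights of
total mass at most `p`. -/
lemma abs_le_of_recurrence (hq0 : 0 < q) (hp : 0 < p) (ha : ∀ k, 0 ≤ a k)
    (ha0 : a 0 = 0) (hap : HasSum a p)
    (hd : ∀ j, p * (1 - q ^ j) * d j = -q ^ j * ∑ k ∈ Finset.range (j + 1), a k * d (j - k))
    {j : ℕ} {B : ℝ} (hB : ∀ i < j, |d i| ≤ B) (hB0 : 0 ≤ B) (hqj : q ^ j < 1) :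
    |d j| * (1 - q ^ j) ≤ q ^ j * B := by
  have hsum : |∑ k ∈ Finset.range (j + 1), a k * d (j - k)| ≤ p * B := by
    calc |∑ k ∈ Finset.range (j + 1), a k * d (j - k)|
        ≤ ∑ k ∈ Finset.range (j + 1), |a k * d (j - k)| := Finset.abs_sum_le_sum_abs _ _
      _ ≤ ∑ k ∈ Finset.range (j + 1), a k * B := by
          refine Finset.sum_le_sum fun k _ => ?_
          rcases Nat.eq_zero_or_pos k with rfl | hk
          · simp [ha0]
          · rcases Nat.eq_zero_or_pos j with rfl | hj
            · exfalso
              simp at hqj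
            · rw [abs_mul, abs_of_nonneg (ha k)]
              exact mul_le_mul_of_nonneg_left (hB _ (by omega)) (ha k)
      _ = (∑ k ∈ Finset.range (j + 1), a k) * B := by rw [Finset.sum_mul]
      _ ≤ p * B := mul_le_mul_of_nonneg_right (sum_le_hasSum _ (fun k _ => ha k) hap) hB0
  have h := congrArg abs (hd j)
  have hpos : 0 < 1 - q ^ j := by linarith
  rw [abs_mul, abs_mul, abs_mul, abs_neg, abs_of_pos hp, abs_of_pos hpos,
    abs_of_pos (pow_pos hq0 j)] at h
  have h2 : p * (|d j| * (1 - q ^ j)) ≤ p * (q ^ j * B) := by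
    calc p * (|d j| * (1 - q ^ j)) = p * (1 - q ^ j) * |d j| := by ring
      _ = q ^ j * |∑ k ∈ Finset.range (j + 1), a k * d (j - k)| := h
      _ ≤ q ^ j * (p * B) := mul_le_mul_of_nonneg_left hsum (pow_pos hq0 j).le
      _ = p * (q ^ j * B) := by ring
  exact le_of_mul_le_mul_left h2 hp

/-- A bootstrap: once `q ^ j < 1 / 2`, the factor `q ^ j / (1 - q ^ j)` is below `1`, so a bound for
the initial terms persists. Feeding the uniform bound back into the recurrence gives geometric
decay. -/
lemma summable_of_recurrence (hq0 : 0 < q) (hq1 : q < 1) (hp : 0 < p) (ha : ∀ k, 0 ≤ a k)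
    (ha0 : a 0 = 0) (hap : HasSum a p)
    (hd : ∀ j, p * (1 - q ^ j) * d j = -q ^ j * ∑ k ∈ Finset.range (j + 1), a k * d (j - k)) :
    Summable d := by
  obtain ⟨J, hJ⟩ := exists_pow_lt_of_lt_one (by norm_num : (0 : ℝ) < 1 / 2) hq1
  set B := ∑ i ∈ Finset.range (J + 1), |d i| with hBdef
  have hB0 : 0 ≤ B := Finset.sum_nonneg fun _ _ => abs_nonneg _
  have hbound : ∀ j, |d j| ≤ B := by
    intro j
    induction j using Nat.strong_induction_on with
    | _ j ih =>
      rcases le_or_gt j J with hj | hj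
      · exact Finset.single_le_sum (f := fun i => |d i|) (fun _ _ => abs_nonneg _)
          (Finset.mem_range.2 (by omega))
      · have hqj : q ^ j < 1 / 2 := (pow_le_pow_of_le_one hq0.le hq1.le hj.le).trans_lt hJ
        have h := abs_le_of_recurrence hq0 hp ha ha0 hap hd ih hB0 (by linarith)
        by_contra! hlt
        nlinarith [pow_pos hq0 j]
  refine (summable_nat_add_iff 1).1 ?_
  refine Summable.of_norm_bounded
    (g := fun j => q ^ (j + 1) * (B / (1 - q))) ?_ ?_
  · exact ((summable_nat_add_iff 1).2 (summable_geometric_of_lt_one hq0.le hq1)).mul_right _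
  · intro j
    have h1 : q ^ (j + 1) ≤ q := by
      simpa using pow_le_pow_of_le_one hq0.le hq1.le (Nat.succ_le_succ (Nat.zero_le j))
    have h := abs_le_of_recurrence (j := j + 1) hq0 hp ha ha0 hap hd (fun i _ => hbound i) hB0
      (by linarith)
    have h3 : |d (j + 1)| * (1 - q) ≤ q ^ (j + 1) * B :=
      (mul_le_mul_of_nonneg_left (by linarith) (abs_nonneg _)).trans h
    rw [Real.norm_eq_abs, ← mul_div_assoc, le_div_iff₀ (by linarith)]
    exact h3

lemma summable_mul_pow_of_summable (hd : Summable d) {x : ℝ} (hx0 : 0 ≤ x) (hx1 : x ≤ 1) :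
    Summable fun j => d j * x ^ j :=
  hd.abs.of_norm_bounded fun j => by
    rw [norm_mul, Real.norm_eq_abs, norm_pow, Real.norm_of_nonneg hx0]
    exact mul_le_of_le_one_right (abs_nonneg _) (pow_le_one₀ hx0 hx1)

/-- The functional equation for the generating function of a solution of the recurrence. -/
lemma generating_functional_equation (hq0 : 0 < q) (hq1 : q < 1) (hap : HasSum a p)
    (hd : ∀ j, p * (1 - q ^ j) * d j = -q ^ j * ∑ k ∈ Finset.range (j + 1), a k * d (j - k))
    (hds : Summable d) {x : ℝ} (hx0 : 0 ≤ x) (hx1 : x ≤ 1) :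
    p * ∑' j, d j * x ^ j = (p - ∑' k, a k * (q * x) ^ k) * ∑' j, d j * (q * x) ^ j := by
  have hqx0 : 0 ≤ q * x := mul_nonneg hq0.le hx0
  have hqx1 : q * x ≤ 1 := mul_le_one₀ hq1.le hx0 hx1
  have s1 := summable_mul_pow_of_summable hds hx0 hx1
  have s2 := summable_mul_pow_of_summable hds hqx0 hqx1
  have s3 := summable_mul_pow_of_summable hap.summable hqx0 hqx1
  have hc := tsum_mul_tsum_eq_tsum_sum_range_of_summable_norm s3.norm s2.norm
  -- The coefficients of the Cauchy product of the two series at `q * x`: the recurrence turns each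
  -- one into a difference of terms at `q * x` and at `x`.
  have key : ∀ j, ∑ k ∈ Finset.range (j + 1), a k * (q * x) ^ k * (d (j - k) * (q * x) ^ (j - k))
      = p * (d j * (q * x) ^ j) - p * (d j * x ^ j) := by
    intro j
    have : ∑ k ∈ Finset.range (j + 1), a k * (q * x) ^ k * (d (j - k) * (q * x) ^ (j - k))
        = (∑ k ∈ Finset.range (j + 1), a k * d (j - k)) * (q * x) ^ j := by
      rw [Finset.sum_mul]
      refine Finset.sum_congr rfl fun k hk => ?_
      rw [← Nat.add_sub_of_le (Nat.lt_succ_iff.1 (Finset.mem_range.1 hk)), Nat.add_sub_cancel_left,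
        pow_add]
      ring
    rw [this, mul_pow]
    linear_combination x ^ j * hd j
  rw [tsum_congr key, (s2.mul_left p).tsum_sub (s1.mul_left p), tsum_mul_left, tsum_mul_left] at hc
  linear_combination hc

/-- The functional equation iterated along `1, q, q ^ 2, …`. Up to powers of the intensity, the
product is the denominator of the `n`-th moment. -/
lemma generating_eq_prod (hq0 : 0 < q) (hq1 : q < 1) (hap : HasSum a p)
    (hd : ∀ j, p * (1 - q ^ j) * d j = -q ^ j * ∑ k ∈ Finset.range (j + 1), a k * d (j - k))
    (hds : Summable d) (n : ℕ) :
    p ^ n * ∑' j, d j =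
      (∏ i ∈ Finset.range n, (p - ∑' k, a k * (q ^ (i + 1)) ^ k)) * ∑' j, d j * (q ^ n) ^ j := by
  induction n with
  | zero => simp
  | succ n ih =>
    have h := generating_functional_equation hq0 hq1 hap hd hds (pow_pos hq0 n).le
      (pow_le_one₀ hq0.le hq1.le)
    rw [← pow_succ'] at h
    rw [pow_succ', mul_assoc, ih, Finset.prod_range_succ]
    linear_combination (∏ i ∈ Finset.range n, (p - ∑' k, a k * (q ^ (i + 1)) ^ k)) * h

/-- The difference `p - ∑ a_k y ^ k` is at least `p * (1 - y)`. -/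
lemma le_sub_tsum_mul_pow (ha : ∀ k, 0 ≤ a k) (ha0 : a 0 = 0) (hap : HasSum a p) {y : ℝ}
    (hy0 : 0 ≤ y) (hy1 : y ≤ 1) : p * (1 - y) ≤ p - ∑' k, a k * y ^ k := by
  have h : ∑' k, a k * y ^ k ≤ ∑' k, a k * y := by
    refine (summable_mul_pow_of_summable hap.summable hy0 hy1).tsum_le_tsum (fun k => ?_)
      (hap.summable.mul_right y)
    rcases Nat.eq_zero_or_pos k with rfl | hk
    · simp [ha0]
    · exact mul_le_mul_of_nonneg_left (pow_le_of_le_one hy0 hy1 hk.ne') (ha k)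
  rw [tsum_mul_right, hap.tsum_eq] at h
  linarith

/-- The terms `d j` may change sign, so positivity is not termwise. It comes from the product
formula: all its factors are positive, and the generating function at `q ^ n` tends to `d 0 = 1`. -/
lemma tsum_pos_of_recurrence (hq0 : 0 < q) (hq1 : q < 1) (hp : 0 < p) (ha : ∀ k, 0 ≤ a k)
    (ha0 : a 0 = 0) (hap : HasSum a p) (hd0 : d 0 = 1)
    (hd : ∀ j, p * (1 - q ^ j) * d j = -q ^ j * ∑ k ∈ Finset.range (j + 1), a k * d (j - k)) :
    0 < ∑' j, d j := by
  have hds := summable_of_recurrence hq0 hq1 hp ha ha0 hap hd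
  have hlim : Filter.Tendsto (fun n : ℕ => ∑' j, d j * (q ^ n) ^ j) Filter.atTop
      (nhds (∑' j, d j * (0 : ℝ) ^ j)) := by
    refine tendsto_tsum_of_dominated_convergence hds.abs (fun j => ?_) (.of_forall fun n j => ?_)
    · exact ((tendsto_pow_atTop_nhds_zero_of_lt_one hq0.le hq1).pow j).const_mul _
    · rw [norm_mul, Real.norm_eq_abs, Real.norm_of_nonneg (by positivity)]
      exact mul_le_of_le_one_right (abs_nonneg _)
        (pow_le_one₀ (by positivity) (pow_le_one₀ hq0.le hq1.le))
  have h0 : ∑' j, d j * (0 : ℝ) ^ j = 1 := by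
    rw [tsum_eq_single 0 (fun j hj => by simp [hj])]
    simp [hd0]
  rw [h0] at hlim
  obtain ⟨n, hn⟩ := (hlim.eventually (lt_mem_nhds zero_lt_one)).exists
  have h := generating_eq_prod hq0 hq1 hap hd hds n
  have hpos : 0 < p ^ n * ∑' j, d j := by
    rw [h]
    refine mul_pos (Finset.prod_pos fun i _ => ?_) hn
    refine lt_of_lt_of_le ?_ (le_sub_tsum_mul_pow ha ha0 hap (pow_pos hq0 _).le
      (pow_le_one₀ hq0.le hq1.le))
    have : q ^ (i + 1) < 1 := pow_lt_one₀ hq0.le hq1 (by omega)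
    exact mul_pos hp (by linarith)
  exact pos_of_mul_pos_right hpos (pow_pos hp n).le

end Recurrence

/-- The rescaled coefficients `c_j q ^ j` solve a recurrence without negative powers of `q`. -/
lemma coeff_mul_pow_recurrence {Ω : Type*} [MeasurableSpace Ω] (P : Measure Ω) (Z₁ : Ω → ℕ)
    {q : ℝ} (hq0 : 0 < q) (hq1 : q < 1) (hp : 0 < P.real {ω | 1 ≤ Z₁ ω}) (j : ℕ) :
    P.real {ω | 1 ≤ Z₁ ω} * (1 - q ^ j) * (coeff P Z₁ q j * q ^ j) =
      -q ^ j * ∑ k ∈ Finset.range (j + 1),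
        (if k = 0 then 0 else P.real {ω | Z₁ ω = k}) * (coeff P Z₁ q (j - k) * q ^ (j - k)) := by
  -- At `j = 0` both sides vanish, so the recurrence leaves the value at `0` free; it is supplied
  -- separately by `coeff_zero`.
  rcases Nat.eq_zero_or_pos j with rfl | hj
  · simp
  have hqj : q ^ j < 1 := pow_lt_one₀ hq0.le hq1 hj.ne'
  have hqj0 : 0 < q ^ j := pow_pos hq0 j
  have h1 : ∑ k ∈ Finset.range (j + 1),
        (if k = 0 then 0 else P.real {ω | Z₁ ω = k}) * (coeff P Z₁ q (j - k) * q ^ (j - k)) =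
      q ^ j * ∑ k ∈ Finset.Icc 1 j, q ^ (-(k : ℤ)) * P.real {ω | Z₁ ω = k} *
        coeff P Z₁ q (j - k) := by
    rw [Finset.mul_sum, Finset.range_eq_Ico, Finset.sum_eq_sum_Ico_succ_bot (by omega),
      if_pos rfl, zero_mul, zero_add, zero_add, Finset.Ico_add_one_right_eq_Icc]
    refine Finset.sum_congr rfl fun k hk => ?_
    obtain ⟨hk1, hk2⟩ := Finset.mem_Icc.1 hk
    rw [if_neg (by omega)]
    have : q ^ j = q ^ k * q ^ (j - k) := by rw [← pow_add, Nat.add_sub_of_le hk2]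
    rw [this, zpow_neg, zpow_natCast]
    field_simp
  rw [h1, coeff_eq P Z₁ q j hj, zpow_neg, zpow_natCast]
  have h2 : 1 - (q ^ j)⁻¹ ≠ 0 := by
    have := one_lt_inv_iff₀.2 ⟨hqj0, hqj⟩
    linarith
  have h3 : 1 - q ^ j = -(q ^ j * (1 - (q ^ j)⁻¹)) := by
    field_simp
    ring
  rw [h3]
  generalize ∑ k ∈ Finset.Icc 1 j, q ^ (-(k : ℤ)) * P.real {ω | Z₁ ω = k} *
    coeff P Z₁ q (j - k) = T
  generalize 1 - (q ^ j)⁻¹ = u at h2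
  field_simp

/-! ### Determinacy of the moment problem, and moments of exponential laws. -/

/-- The exponential series, for the extended nonnegative numbers. -/
lemma ofReal_exp_mul_eq_tsum {r x : ℝ} (hr : 0 ≤ r) (hx : 0 ≤ x) :
    ENNReal.ofReal (Real.exp (r * x)) =
      ∑' n : ℕ, ENNReal.ofReal (r ^ n / n.factorial) * ENNReal.ofReal x ^ n := by
  have h : HasSum (fun n : ℕ => (r * x) ^ n / n.factorial) (Real.exp (r * x)) := by
    rw [Real.exp_eq_exp_ℝ]
    exact NormedSpace.expSeries_div_hasSum_exp (r * x)
  rw [← h.tsum_eq, ENNReal.ofReal_tsum_of_nonneg (fun n => by positivity) h.summable]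
  refine tsum_congr fun n => ?_
  rw [← ENNReal.ofReal_pow hx, ← ENNReal.ofReal_mul (by positivity), mul_pow]
  congr 1
  ring

/-- Expanding the exponential, the factorial in the moment bound cancels that of the series and
leaves a geometric series of ratio `r * R`. -/
lemma lintegral_exp_lt_top_of_moments {μ : Measure ℝ} (hμ : ∀ᵐ x ∂μ, 0 ≤ x) {C R r : ℝ}
    (hC : 0 ≤ C) (hr : 0 ≤ r) (hR : 0 ≤ R) (hrR : r * R < 1)
    (hm : ∀ n : ℕ, ∫⁻ x, ENNReal.ofReal x ^ n ∂μ ≤ ENNReal.ofReal (C * n.factorial * R ^ n)) :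
    ∫⁻ x, ENNReal.ofReal (Real.exp (r * x)) ∂μ < ∞ := by
  calc ∫⁻ x, ENNReal.ofReal (Real.exp (r * x)) ∂μ
      = ∫⁻ x, ∑' n : ℕ, ENNReal.ofReal (r ^ n / n.factorial) * ENNReal.ofReal x ^ n ∂μ :=
        lintegral_congr_ae (hμ.mono fun x hx => ofReal_exp_mul_eq_tsum hr hx)
    _ = ∑' n : ℕ, ENNReal.ofReal (r ^ n / n.factorial) * ∫⁻ x, ENNReal.ofReal x ^ n ∂μ := by
        rw [lintegral_tsum fun n => by fun_prop]
        exact tsum_congr fun n => lintegral_const_mul _ (by fun_prop)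
    _ ≤ ∑' n : ℕ, ENNReal.ofReal (C * (r * R) ^ n) := by
        refine ENNReal.tsum_le_tsum fun n => (mul_le_mul_right (hm n) _).trans_eq ?_
        rw [← ENNReal.ofReal_mul (by positivity)]
        congr 1
        have : (n.factorial : ℝ) ≠ 0 := by positivity
        rw [mul_pow]
        field_simp
    _ < ∞ := by
        rw [← ENNReal.ofReal_tsum_of_nonneg (fun n => by positivity)
          ((summable_geometric_of_lt_one (by positivity) hrR).mul_left C)]
        exact ENNReal.ofReal_lt_top

lemma zero_mem_interior_integrableExpSet {μ : Measure ℝ} [IsFiniteMeasure μ]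
    (hμ : ∀ᵐ x ∂μ, 0 ≤ x) {r : ℝ}
    (h : ∫⁻ x, ENNReal.ofReal (Real.exp (r * x)) ∂μ < ∞) :
    Ioo (-r) r ⊆ interior (integrableExpSet id μ) := by
  have hint : Integrable (fun x => Real.exp (r * x)) μ := by
    refine ⟨by fun_prop, ?_⟩
    rw [hasFiniteIntegral_iff_ofReal (.of_forall fun x => (Real.exp_pos _).le)]
    exact h
  refine interior_maximal (fun t ht => ?_) isOpen_Ioo
  refine hint.mono' (by fun_prop) (hμ.mono fun x hx => ?_)
  rw [Real.norm_of_nonneg (Real.exp_pos _).le]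
  exact Real.exp_le_exp.2 (mul_le_mul_of_nonneg_right ht.2.le hx)

/-- Finite measures on the half-line whose moments coincide and do not grow faster than
`C * n! * R ^ n` are equal. -/
theorem measure_eq_of_moments_eq {μ ν : Measure ℝ} [IsFiniteMeasure μ] [IsFiniteMeasure ν]
    (hμ : ∀ᵐ x ∂μ, 0 ≤ x) (hν : ∀ᵐ x ∂ν, 0 ≤ x)
    (h : ∀ n : ℕ, ∫⁻ x, ENNReal.ofReal x ^ n ∂μ = ∫⁻ x, ENNReal.ofReal x ^ n ∂ν) {C R : ℝ}
    (hC : 0 ≤ C) (hR : 0 < R)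
    (hm : ∀ n : ℕ, ∫⁻ x, ENNReal.ofReal x ^ n ∂μ ≤ ENNReal.ofReal (C * n.factorial * R ^ n)) :
    μ = ν := by
  set r : ℝ := 1 / (2 * R) with hrdef
  have hr : 0 < r := by positivity
  have hrR : r * R < 1 := by
    rw [hrdef]
    field_simp
    norm_num
  have hμr := zero_mem_interior_integrableExpSet hμ
    (lintegral_exp_lt_top_of_moments hμ hC hr.le hR.le hrR hm)
  have hνr := zero_mem_interior_integrableExpSet hν
    (lintegral_exp_lt_top_of_moments hν hC hr.le hR.le hrR fun n => (h n).symm.trans_le (hm n))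
  have hmom : ∀ n : ℕ, ∫ x, x ^ n ∂μ = ∫ x, x ^ n ∂ν := by
    have aux : ∀ (ρ : Measure ℝ), (∀ᵐ x ∂ρ, 0 ≤ x) → ∀ n : ℕ,
        ∫ x, x ^ n ∂ρ = (∫⁻ x, ENNReal.ofReal x ^ n ∂ρ).toReal := fun ρ hρ n => by
      rw [integral_eq_lintegral_of_nonneg_ae (hρ.mono fun x hx => pow_nonneg hx n) (by fun_prop)]
      congr 1
      exact lintegral_congr_ae (hρ.mono fun x hx => ENNReal.ofReal_pow hx n)
    intro n
    rw [aux μ hμ, aux ν hν, h n]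
  -- Both complex moment generating functions are analytic on this strip. Their Taylor coefficients
  -- at `0` are given by the moments, so they agree near `0`, hence on the connected strip. The
  -- strip contains the imaginary axis, where they are the characteristic functions.
  set U : Set ℂ := {z | z.re ∈ Ioo (-r) r} with hU
  have hUpre : IsPreconnected U :=
    ((convex_Ioo (-r) r).linear_preimage Complex.reLm).isPreconnected
  have h0U : (0 : ℂ) ∈ U := by simp [hU, hr]
  have hUμ : U ⊆ {z | z.re ∈ interior (integrableExpSet id μ)} := fun z hz => hμr hz
  have hUν : U ⊆ {z | z.re ∈ interior (integrableExpSet id ν)} := fun z hz => hνr hz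
  have hEq : EqOn (complexMGF id μ) (complexMGF id ν) U := by
    have aμ := analyticOnNhd_complexMGF.mono hUμ
    have aν := analyticOnNhd_complexMGF.mono hUν
    refine aμ.eqOn_of_preconnected_of_eventuallyEq aν hUpre h0U ?_
    have sμ := (aμ 0 h0U).hasFPowerSeriesAt
    have sν := (aν 0 h0U).hasFPowerSeriesAt
    have hder : ∀ n, iteratedDeriv n (complexMGF id μ) 0 = iteratedDeriv n (complexMGF id ν) 0 := by
      intro n
      rw [iteratedDeriv_complexMGF (hUμ h0U), iteratedDeriv_complexMGF (hUν h0U)]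
      have := congrArg (fun y : ℝ => (y : ℂ)) (hmom n)
      simp only [← integral_complex_ofReal] at this
      simpa using this
    simp only [← hder] at sν
    filter_upwards [sμ.eventually_hasSum_sub, sν.eventually_hasSum_sub] with z h1 h2
    exact h1.unique h2
  refine Measure.ext_of_charFun (funext fun t => ?_)
  rw [← complexMGF_id_mul_I, ← complexMGF_id_mul_I]
  exact hEq (by simp [hU, hr])

lemma lintegral_pow_expMeasure {r : ℝ} (hr : 0 < r) (n : ℕ) :
    ∫⁻ x, ENNReal.ofReal x ^ n ∂(expMeasure r) = ENNReal.ofReal (n.factorial * (1 / r) ^ n) := by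
  have hmeas : Measurable (exponentialPDF r) := (measurable_exponentialPDFReal r).ennreal_ofReal
  have : expMeasure r = volume.withDensity (exponentialPDF r) := rfl
  rw [this, lintegral_withDensity_eq_lintegral_mul _ hmeas (by fun_prop)]
  -- The density does not vanish at `0`, so that point is split off as a null set to reach an
  -- integral over `Ioi 0`.
  have h1 : ∀ x : ℝ, (exponentialPDF r * fun x => ENNReal.ofReal x ^ n) x =
      (Ioi 0).indicator (fun x => ENNReal.ofReal (r * (x ^ n * Real.exp (-(r * x))))) x +
      ({0} : Set ℝ).indicator (fun x => exponentialPDF r x * ENNReal.ofReal x ^ n) x := by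
    intro x
    rcases lt_trichotomy x 0 with hx | rfl | hx
    · simp [exponentialPDF_of_neg hx, hx.le, hx.ne]
    · simp
    · simp only [Pi.mul_apply, mem_Ioi, hx, indicator_of_mem, mem_singleton_iff, hx.ne',
        not_false_eq_true, indicator_of_notMem, add_zero, exponentialPDF_of_nonneg hx.le]
      rw [← ENNReal.ofReal_pow hx.le, ← ENNReal.ofReal_mul (by positivity)]
      congr 1
      ring
  have h2 := Real.integral_rpow_mul_exp_neg_mul_Ioi (a := n + 1) (r := r) (by positivity) hr
  have h3 : ∀ x ∈ Ioi (0 : ℝ), x ^ ((n + 1 : ℝ) - 1) * Real.exp (-(r * x)) =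
      x ^ n * Real.exp (-(r * x)) := fun x _ => by
    rw [add_sub_cancel_right, Real.rpow_natCast]
  rw [setIntegral_congr_fun measurableSet_Ioi h3, Real.Gamma_nat_eq_factorial] at h2
  -- A non-integrable function would have Bochner integral `0`, whereas the Gamma integral is
  -- positive.
  have h4 : IntegrableOn (fun x : ℝ => x ^ n * Real.exp (-(r * x))) (Ioi 0) := by
    by_contra hcon
    rw [integral_undef hcon] at h2
    have : 0 < (1 / r) ^ ((n : ℝ) + 1) * n.factorial := by positivity
    linarith
  rw [lintegral_congr h1, lintegral_add_left (by measurability),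
    lintegral_indicator measurableSet_Ioi, lintegral_indicator (measurableSet_singleton 0)]
  rw [Measure.restrict_singleton, Real.volume_singleton, zero_smul, lintegral_zero_measure,
    add_zero, ← ofReal_integral_eq_lintegral_ofReal (h4.const_mul r), integral_const_mul, h2]
  · congr 1
    rw [Real.rpow_add (by positivity), Real.rpow_natCast, Real.rpow_one]
    field_simp
  · filter_upwards [self_mem_ae_restrict measurableSet_Ioi] with x hx
    have : (0 : ℝ) < x := hx
    show 0 ≤ r * (x ^ n * Real.exp (-(r * x)))
    positivity

lemma ae_nonneg_expMeasure (r : ℝ) : ∀ᵐ x ∂(expMeasure r), 0 ≤ x := by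
  have : expMeasure r = volume.withDensity (exponentialPDF r) := rfl
  rw [this, ae_iff]
  have hs : {a : ℝ | ¬ 0 ≤ a} = Iio 0 := by ext; simp
  rw [hs, withDensity_apply _ measurableSet_Iio]
  exact lintegral_exponentialPDF_of_nonpos le_rfl

lemma expMeasure_Ioi {r : ℝ} (hr : 0 < r) {x : ℝ} (hx : 0 ≤ x) :
    expMeasure r (Ioi x) = ENNReal.ofReal (Real.exp (-(r * x))) := by
  have := isProbabilityMeasure_expMeasure hr
  have h := cdf_expMeasure_eq hr x
  rw [if_pos hx, cdf_eq_real] at h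
  rw [← compl_Iic, ← ofReal_measureReal, probReal_compl_eq_one_sub measurableSet_Iic, h]
  congr 1
  ring

/-! ### Powers of a tail integral as ordered iterated integrals. -/

section IteratedTail

/-- The iterated tail integrals `∫_{t < s₁ < ⋯ < sₙ} f s₁ ⋯ f sₙ ds`. -/
noncomputable def iterTail (f : ℝ → ℝ≥0∞) : ℕ → ℝ → ℝ≥0∞
  | 0, _ => 1
  | n + 1, t => ∫⁻ s in Ioi t, f s * iterTail f n s

lemma measurable_iterTail_prod {Ω : Type*} [MeasurableSpace Ω] {f : ℝ → Ω → ℝ≥0∞}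
    (hf : Measurable (Function.uncurry f)) (n : ℕ) :
    Measurable fun p : ℝ × Ω => iterTail (fun s => f s p.2) n p.1 := by
  induction n with
  | zero => exact measurable_const
  | succ n ih =>
    have h : ∀ p : ℝ × Ω, iterTail (fun s => f s p.2) (n + 1) p.1 =
        ∫⁻ s, {r : (ℝ × Ω) × ℝ | r.1.1 < r.2}.indicator
          (fun r => f r.2 r.1.2 * iterTail (fun s => f s r.1.2) n r.2) (p, s) := by
      intro p
      rw [iterTail, ← lintegral_indicator measurableSet_Ioi]
      rfl
    simp_rw [h]
    refine Measurable.lintegral_prod_right' (Measurable.indicator ?_ ?_)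
    · have h1 : Measurable fun r : (ℝ × Ω) × ℝ => (r.2, r.1.2) := by fun_prop
      exact (hf.comp h1).mul (ih.comp h1)
    · exact measurableSet_lt (by fun_prop) (by fun_prop)

lemma measurable_iterTail {f : ℝ → ℝ≥0∞} (hf : Measurable f) (n : ℕ) :
    Measurable (iterTail f n) := by
  have h := measurable_iterTail_prod (Ω := Unit) (f := fun s _ => f s) (hf.comp measurable_fst) n
  exact h.comp (measurable_id.prodMk (measurable_const (a := ())))

/-- The extra variable can fall into any of the `n + 1` gaps between the ordered ones, and each
position contributes the same ordered integral. The induction splits according to whether it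
precedes the smallest variable `u`: if so, Tonelli makes it the new smallest variable; if not, the
induction hypothesis at `u` applies. -/
lemma tail_mul_iterTail {f : ℝ → ℝ≥0∞} (hf : Measurable f) (n : ℕ) (t : ℝ) :
    (∫⁻ s in Ioi t, f s) * iterTail f n t = (n + 1) * iterTail f (n + 1) t := by
  induction n generalizing t with
  | zero => simp [iterTail]
  | succ n ih =>
    have hg : Measurable fun u => f u * iterTail f n u := hf.mul (measurable_iterTail hf n)
    have hK := measurable_iterTail hf (n + 1)
    have hinner : ∀ u, t < u → ∫⁻ s in Ioi t, f s =
        (∫⁻ s in Ioi t, (Iic u).indicator f s) + ∫⁻ s in Ioi u, f s := by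
      intro u hu
      rw [lintegral_indicator measurableSet_Iic, Measure.restrict_restrict measurableSet_Iic,
        inter_comm, Ioi_inter_Iic, ← lintegral_union measurableSet_Ioi
          (Ioc_disjoint_Ioi le_rfl), Ioc_union_Ioi_eq_Ioi hu.le]
    calc (∫⁻ s in Ioi t, f s) * iterTail f (n + 1) t
        = ∫⁻ u in Ioi t, (∫⁻ s in Ioi t, f s) * (f u * iterTail f n u) := by
          rw [iterTail, lintegral_const_mul _ hg]
      _ = ∫⁻ u in Ioi t, ((∫⁻ s in Ioi t, (Iic u).indicator f s) * (f u * iterTail f n u) +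
            (n + 1) * (f u * iterTail f (n + 1) u)) := by
          refine setLIntegral_congr_fun measurableSet_Ioi fun u hu => ?_
          rw [hinner u hu, add_mul]
          congr 1
          rw [mul_left_comm, ih, mul_left_comm]
      _ = (∫⁻ u in Ioi t, ∫⁻ s in Ioi t, (Iic u).indicator f s * (f u * iterTail f n u)) +
            (n + 1) * iterTail f (n + 2) t := by
          have hfK : Measurable fun u => f u * iterTail f (n + 1) u := hf.mul hK
          rw [lintegral_add_right _ (hfK.const_mul _), lintegral_const_mul _ hfK]
          congr 1
          refine lintegral_congr fun u => ?_
          rw [lintegral_mul_const _ (hf.indicator measurableSet_Iic)]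
      _ = (∫⁻ s in Ioi t, f s * iterTail f (n + 1) s) + (n + 1) * iterTail f (n + 2) t := by
          congr 1
          rw [lintegral_lintegral_swap]
          · refine setLIntegral_congr_fun measurableSet_Ioi fun s hs => ?_
            have h1 : ∀ u, (Iic u).indicator f s * (f u * iterTail f n u) =
                f s * (Ici s).indicator (fun u => f u * iterTail f n u) u := by
              intro u
              by_cases hsu : s ≤ u
              · simp [hsu]
              · simp [hsu]
            simp only [h1]
            rw [lintegral_const_mul _ (hg.indicator measurableSet_Ici),
              lintegral_indicator measurableSet_Ici, Measure.restrict_restrict measurableSet_Ici,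
              inter_eq_left.2 (Ici_subset_Ioi.2 hs), setLIntegral_congr Ioi_ae_eq_Ici.symm, iterTail]
          · refine Measurable.aemeasurable (Measurable.mul ?_ (hg.comp measurable_fst))
            have : (Function.uncurry fun (u s : ℝ) => (Iic u).indicator f s) =
                {r : ℝ × ℝ | r.2 ≤ r.1}.indicator (fun r => f r.2) := by
              ext r
              simp [Function.uncurry, indicator]
            show Measurable (Function.uncurry fun (u s : ℝ) => (Iic u).indicator f s)
            rw [this]
            exact (hf.comp measurable_snd).indicator
              (measurableSet_le measurable_snd measurable_fst)
      _ = ((n + 1 : ℕ) + 1) * iterTail f (n + 2) t := by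
          change iterTail f (n + 2) t + _ = _
          push_cast
          ring

lemma tail_pow_eq {f : ℝ → ℝ≥0∞} (hf : Measurable f) (n : ℕ) (t : ℝ) :
    (∫⁻ s in Ioi t, f s) ^ n = n.factorial * iterTail f n t := by
  induction n with
  | zero => simp [iterTail]
  | succ n ih =>
    rw [pow_succ', ih, mul_left_comm, tail_mul_iterTail hf, Nat.factorial_succ]
    push_cast
    ring

end IteratedTail

/-! ### Independence of the past and a later increment. -/

section Independence

variable {Ω : Type*}

lemma generateFrom_image2_inter (A C : MeasurableSpace Ω) :
    A ⊔ C = MeasurableSpace.generateFrom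
      (image2 (· ∩ ·) {s | MeasurableSet[A] s} {s | MeasurableSet[C] s}) := by
  refine le_antisymm (sup_le (fun s hs => ?_) (fun s hs => ?_))
    (MeasurableSpace.generateFrom_le ?_)
  · exact MeasurableSpace.measurableSet_generateFrom
      ⟨s, hs, univ, @MeasurableSet.univ _ C, inter_univ s⟩
  · exact MeasurableSpace.measurableSet_generateFrom
      ⟨univ, @MeasurableSet.univ _ A, s, hs, univ_inter s⟩
  · rintro _ ⟨a, ha, c, hc, rfl⟩
    exact MeasurableSet.inter ((le_sup_left : A ≤ A ⊔ C) a ha) ((le_sup_right : C ≤ A ⊔ C) c hc)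

lemma isPiSystem_image2_inter (A C : MeasurableSpace Ω) :
    IsPiSystem (image2 (· ∩ ·) {s | MeasurableSet[A] s} {s | MeasurableSet[C] s}) := by
  rintro _ ⟨a, ha, c, hc, rfl⟩ _ ⟨a', ha', c', hc', rfl⟩ _
  exact ⟨a ∩ a', MeasurableSet.inter ha ha', c ∩ c', MeasurableSet.inter hc hc',
    inter_inter_inter_comm a a' c c'⟩

variable [mΩ : MeasurableSpace Ω] {P : Measure Ω}

/-- Two independent pairs of independent σ-algebras can be regrouped. -/
lemma indep_sup_sup [IsProbabilityMeasure P] {A B C D : MeasurableSpace Ω}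
    (hA : A ≤ mΩ) (hB : B ≤ mΩ) (hC : C ≤ mΩ) (hD : D ≤ mΩ)
    (h : Indep (A ⊔ B) (C ⊔ D) P) (hAB : Indep A B P) (hCD : Indep C D P) :
    Indep (A ⊔ C) (B ⊔ D) P := by
  refine IndepSets.indep (sup_le hA hC) (sup_le hB hD) (isPiSystem_image2_inter A C)
    (isPiSystem_image2_inter B D) (generateFrom_image2_inter A C)
    (generateFrom_image2_inter B D) ?_
  rw [IndepSets_iff]
  rintro _ _ ⟨a, ha, c, hc, rfl⟩ ⟨b, hb, d, hd, rfl⟩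
  rw [Indep_iff] at h hAB hCD
  have lA : A ≤ A ⊔ B := le_sup_left
  have lB : B ≤ A ⊔ B := le_sup_right
  have lC : C ≤ C ⊔ D := le_sup_left
  have lD : D ≤ C ⊔ D := le_sup_right
  simp only []
  rw [inter_inter_inter_comm, h _ _ (MeasurableSet.inter (lA a ha) (lB b hb))
      (MeasurableSet.inter (lC c hc) (lD d hd)),
    hAB _ _ ha hb, hCD _ _ hc hd, h a c (lA a ha) (lC c hc), h b d (lB b hb) (lD d hd)]
  ring

/-- Independence of increments is used along a monotone sequence indexed by `ℕ`, so the sorted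
finite set is prolonged by repeating its largest element. -/
lemma exists_monotone_enumeration (F : Finset ℝ≥0) (h0 : 0 ∈ F) :
    ∃ τ : ℕ → ℝ≥0, Monotone τ ∧ τ 0 = 0 ∧ ∀ u ∈ F, ∃ j, τ j = u := by
  have hk : 0 < F.card := Finset.card_pos.2 ⟨0, h0⟩
  set e := F.orderEmbOfFin rfl with he
  have hsurj : ∀ u ∈ F, ∃ i, e i = u := by
    intro u hu
    have : u ∈ Set.range e := by rw [he, Finset.range_orderEmbOfFin]; exact hu
    exact this
  refine ⟨fun i => e ⟨min i (F.card - 1), by omega⟩, ?_, ?_, ?_⟩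
  · intro i j hij
    refine e.monotone ?_
    rw [Fin.mk_le_mk]
    omega
  · obtain ⟨i, hi⟩ := hsurj 0 h0
    refine le_antisymm ?_ zero_le
    rw [← hi]
    refine e.monotone ?_
    rw [Fin.le_def]
    simp
  · intro u hu
    obtain ⟨i, hi⟩ := hsurj u hu
    refine ⟨i, ?_⟩
    rw [← hi]
    exact congrArg e (Fin.ext (min_eq_left (Nat.le_sub_one_of_lt i.2)))

variable {N : ℝ≥0 → Ω → ℕ}

/-- For a process with independent increments, the past is independent of a later increment. -/
lemma indep_past_increment [IsProbabilityMeasure P] (hNm : ∀ t, Measurable (N t))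
    (hN0 : ∀ ω, N 0 ω = 0)
    (hmono : ∀ ω, Monotone fun t => N t ω) (hinc : HasIndepIncrements N P) {t s : ℝ≥0}
    (hts : t ≤ s) :
    Indep (⨆ u : Iic t, MeasurableSpace.comap (N u) inferInstance)
      (MeasurableSpace.comap (fun ω => N s ω - N t ω) inferInstance) P := by
  have hY : Measurable fun ω => N s ω - N t ω := (hNm s).sub (hNm t)
  have hkey : IndepFun (fun ω (u : Iic t) => N u ω) (fun ω => N s ω - N t ω) P := by
    refine IndepFun.process_indepFun (fun u => hNm u) hY fun I => ?_
    classical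
    -- Adjoining `0`, `t` and `s` to the sampled times makes the past values sums of increments with
    -- index below `a`, and the increment over `[t, s]` a sum of increments with index at least `a`:
    -- two disjoint blocks.
    obtain ⟨τ, hτ, hτ0, hτF⟩ := exists_monotone_enumeration
      (insert 0 (insert t (insert s (I.image Subtype.val)))) (by simp)
    obtain ⟨a, ha⟩ := hτF t (by simp)
    obtain ⟨b, hb⟩ := hτF s (by simp)
    have hind := hinc.nat hτ
    set m : ℕ → MeasurableSpace Ω := fun i =>
      MeasurableSpace.comap (fun ω => N (τ (i + 1)) ω - N (τ i) ω) inferInstance with hm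
    have hmle : ∀ i, m i ≤ mΩ := fun i => ((hNm _).sub (hNm _)).comap_le
    have hI : Indep (⨆ i ∈ Iio a, m i) (⨆ i ∈ Ici a, m i) P :=
      indep_iSup_of_disjoint hmle hind.iIndep (Set.Iio_disjoint_Ici le_rfl)
    have hpast : ∀ j ≤ a, Measurable[⨆ i ∈ Iio a, m i] (N (τ j)) := by
      intro j
      induction j with
      | zero =>
        intro _
        have : N (τ 0) = fun _ => 0 := by ext ω; rw [hτ0, hN0]
        rw [this]
        exact @measurable_const _ _ _ (_) _
      | succ j ih =>
        intro hj
        have h1 : N (τ (j + 1)) = fun ω => N (τ j) ω + (N (τ (j + 1)) ω - N (τ j) ω) := by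
          ext ω
          exact (Nat.add_sub_of_le (hmono ω (hτ (Nat.le_succ j)))).symm
        rw [h1]
        have h2 : Measurable[⨆ i ∈ Iio a, m i] fun ω => N (τ (j + 1)) ω - N (τ j) ω :=
          Measurable.mono (comap_measurable _) (le_iSup₂_of_le j (Nat.lt_of_succ_le hj) le_rfl) le_rfl
        exact @Measurable.add _ _ _ _ _ (_) _ _ (ih (by omega)) h2
    have hfut : ∀ j, a ≤ j → Measurable[⨆ i ∈ Ici a, m i] fun ω => N (τ j) ω - N (τ a) ω := by
      intro j hj
      induction j, hj using Nat.le_induction with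
      | base =>
        simp only [Nat.sub_self]
        exact @measurable_const _ _ _ (_) _
      | succ j hj ih =>
        have h1 : (fun ω => N (τ (j + 1)) ω - N (τ a) ω) =
            fun ω => (N (τ j) ω - N (τ a) ω) + (N (τ (j + 1)) ω - N (τ j) ω) := by
          ext ω
          have h3 : N (τ j) ω ≤ N (τ (j + 1)) ω := hmono ω (hτ (Nat.le_succ j))
          have h4 : N (τ a) ω ≤ N (τ j) ω := hmono ω (hτ hj)
          omega
        rw [h1]
        have h2 : Measurable[⨆ i ∈ Ici a, m i] fun ω => N (τ (j + 1)) ω - N (τ j) ω :=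
          Measurable.mono (comap_measurable _) (le_iSup₂_of_le j hj le_rfl) le_rfl
        exact @Measurable.add _ _ _ _ _ (_) _ _ ih h2
    have hleft : Measurable[⨆ i ∈ Iio a, m i] fun ω (u : I) => N u ω := by
      refine @measurable_pi_lambda _ _ _ (_) _ _ fun u => ?_
      obtain ⟨j, hj⟩ := hτF u.1.1 (Finset.mem_insert_of_mem (Finset.mem_insert_of_mem
        (Finset.mem_insert_of_mem (Finset.mem_image_of_mem _ u.2))))
      rcases le_total j a with h | h
      · have := hpast j h
        rwa [hj] at this
      -- The index found for `u` may exceed `a` because of repetitions; `u ≤ t` then forces `u = t`.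
      · have h1 : u.1.1 = τ a := le_antisymm (by rw [ha]; exact u.1.2) (by rw [← hj]; exact hτ h)
        have := hpast a le_rfl
        rwa [← h1] at this
    have hright : Measurable[⨆ i ∈ Ici a, m i] fun ω => N s ω - N t ω := by
      rcases le_total a b with h | h
      · have := hfut b h
        rwa [ha, hb] at this
      · have h1 : s = t := le_antisymm (by rw [← ha, ← hb]; exact hτ h) hts
        have := hfut a le_rfl
        rw [ha] at this
        rwa [h1]
    rw [IndepFun_iff_Indep]
    exact indep_of_indep_of_le_left (indep_of_indep_of_le_right hI hright.comap_le)
      hleft.comap_le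
  rw [IndepFun_iff_Indep] at hkey
  refine indep_of_indep_of_le_left hkey (iSup_le fun u => ?_)
  exact ((measurable_pi_apply u).comp (comap_measurable fun ω (u : Iic t) => N u ω)).comap_le

end Independence

/-! ### The compound process: past, future and the Markov property. -/

/-- A Poisson process all of whose paths are regular, together with independent jump sizes. -/
structure IsRegularCompound {Ω : Type*} [MeasurableSpace Ω] (P : Measure Ω) (lam : ℝ≥0)
    (N : ℝ≥0 → Ω → ℕ) (Z : ℕ → Ω → ℕ) : Prop where
  measurable_count : ∀ t, Measurable (N t)
  zero : ∀ ω, N 0 ω = 0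
  mono : ∀ ω, Monotone fun t => N t ω
  right_cont : ∀ ω t, ContinuousWithinAt (fun t => N t ω) (Ici t) t
  indep_increments : HasIndepIncrements N P
  law_increments : ∀ s t : ℝ≥0, s ≤ t →
    P.map (fun ω => N t ω - N s ω) = poissonMeasure (lam * (t - s))
  measurable_jump : ∀ i, Measurable (Z i)
  indep_jumps : iIndepFun Z P
  law_jumps : ∀ i, IdentDistrib (Z i) (Z 0) P P
  indep : IndepFun (fun ω t => N t ω) (fun ω i => Z i ω) P

/-- The σ-algebra of the counting process up to time `t` and of the first `m` jump sizes. -/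
abbrev pastSigma {Ω : Type*} (N : ℝ≥0 → Ω → ℕ) (Z : ℕ → Ω → ℕ) (t : ℝ≥0) (m : ℕ) :
    MeasurableSpace Ω :=
  (⨆ u : Iic t, MeasurableSpace.comap (N u) inferInstance) ⊔
    (⨆ l ∈ Iio m, MeasurableSpace.comap (Z l) inferInstance)

/-- The σ-algebra of the increment over `[t, s]` and of the jump sizes from the `m`-th on. -/
abbrev futureSigma {Ω : Type*} (N : ℝ≥0 → Ω → ℕ) (Z : ℕ → Ω → ℕ) (t s : ℝ≥0) (m : ℕ) :
    MeasurableSpace Ω :=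
  (MeasurableSpace.comap (fun ω => N s ω - N t ω) inferInstance) ⊔
    (⨆ l ∈ Ici m, MeasurableSpace.comap (Z l) inferInstance)

/-- `X` depends only on the compound process up to time `t`. -/
def IsPast {Ω : Type*} (N : ℝ≥0 → Ω → ℕ) (Z : ℕ → Ω → ℕ) (t : ℝ≥0) (X : Ω → ℝ≥0∞) : Prop :=
  ∀ m, Measurable[pastSigma N Z t m] ({ω | N t ω = m}.indicator X)

section Past

variable {Ω : Type*} {N : ℝ≥0 → Ω → ℕ} {Z : ℕ → Ω → ℕ} {X : Ω → ℝ≥0∞} {t s : ℝ≥0}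

lemma pastSigma_mono (hts : t ≤ s) {m n : ℕ} (hmn : m ≤ n) :
    pastSigma N Z t m ≤ pastSigma N Z s n := by
  refine sup_le_sup (iSup_le fun u => ?_) (biSup_mono fun l hl => ?_)
  · exact le_iSup_of_le (⟨u.1, u.2.trans hts⟩ : Iic s) le_rfl
  · exact lt_of_lt_of_le hl hmn

lemma measurableSet_past_count {u : ℝ≥0} (hu : u ≤ t) (m k : ℕ) :
    MeasurableSet[pastSigma N Z t m] {ω | N u ω = k} := by
  have h : MeasurableSpace.comap (N u) inferInstance ≤ pastSigma N Z t m :=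
    le_sup_of_le_left (le_iSup_of_le (⟨u, hu⟩ : Iic t) le_rfl)
  exact h _ ⟨{k}, measurableSet_singleton k, rfl⟩

lemma measurable_past_jump {m l : ℕ} (hl : l < m) : Measurable[pastSigma N Z t m] (Z l) := by
  have h : MeasurableSpace.comap (Z l) inferInstance ≤ pastSigma N Z t m :=
    le_sup_of_le_right (le_iSup₂_of_le l hl le_rfl)
  exact Measurable.mono (comap_measurable _) h le_rfl

lemma isPast_const (c : ℝ≥0∞) : IsPast N Z t fun _ => c := by
  intro m
  refine @Measurable.indicator _ _ (_) _ _ _ _ ?_ (measurableSet_past_count le_rfl m m)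
  exact @measurable_const _ _ _ (_) c

lemma IsPast.mul_pow (hX : IsPast N Z t X) (R : ℝ≥0∞) :
    IsPast N Z t fun ω => X ω * R ^ compoundSum N Z t ω := by
  intro m
  have h : {ω | N t ω = m}.indicator (fun ω => X ω * R ^ compoundSum N Z t ω) =
      fun ω => {ω | N t ω = m}.indicator X ω * R ^ (∑ i ∈ Finset.range m, Z i ω) := by
    ext ω
    by_cases hω : N t ω = m
    · simp [hω, compoundSum]
    · simp [hω]
  rw [h]
  refine @Measurable.mul _ _ _ _ _ (_) _ _ (hX m) ?_
  have h2 : Measurable[pastSigma N Z t m] fun ω => ∑ i ∈ Finset.range m, Z i ω :=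
    @Finset.measurable_fun_sum _ _ _ _ _ _ (_) _ _ fun i hi =>
      measurable_past_jump (Finset.mem_range.1 hi)
  exact (measurable_from_top (f := fun k : ℕ => R ^ k)).comp h2

/-- On `{N s = m}` the earlier count is some `k ≤ m`, and on each such piece `X` uses only the first
`k` jumps. -/
lemma IsPast.mono (hX : IsPast N Z t X) (hmono : ∀ ω, Monotone fun t => N t ω) (hts : t ≤ s) :
    IsPast N Z s X := by
  intro m
  have h : {ω | N s ω = m}.indicator X = {ω | N s ω = m}.indicator
      (fun ω => ∑ k ∈ Finset.range (m + 1), {ω | N t ω = k}.indicator X ω) := by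
    ext ω
    by_cases hω : N s ω = m
    · have hle : N t ω ≤ N s ω := hmono ω hts
      have hω' : ω ∈ {ω | N s ω = m} := hω
      rw [indicator_of_mem hω', indicator_of_mem hω', Finset.sum_eq_single (N t ω)]
      · simp
      · intro k _ hk
        exact indicator_of_notMem (fun h => hk h.symm) _
      · intro hk
        exact absurd (Finset.mem_range.2 (by omega)) hk
    · have hω' : ω ∉ {ω | N s ω = m} := hω
      rw [indicator_of_notMem hω', indicator_of_notMem hω']
  rw [h]
  refine @Measurable.indicator _ _ (_) _ _ _ _ ?_ (measurableSet_past_count le_rfl m m)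
  exact @Finset.measurable_fun_sum _ _ _ _ _ _ (_) _ _ fun k hk =>
    (hX k).mono (pastSigma_mono hts (Nat.lt_succ_iff.1 (Finset.mem_range.1 hk))) le_rfl

end Past

namespace IsRegularCompound

variable {Ω : Type*} [mΩ : MeasurableSpace Ω] {P : Measure Ω} {lam : ℝ≥0} {N : ℝ≥0 → Ω → ℕ}
  {Z : ℕ → Ω → ℕ} (h : IsRegularCompound P lam N Z)

include h

lemma pastSigma_le (t : ℝ≥0) (m : ℕ) : pastSigma N Z t m ≤ mΩ :=
  sup_le (iSup_le fun u => (h.measurable_count u).comap_le)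
    (iSup₂_le fun l _ => (h.measurable_jump l).comap_le)

lemma futureSigma_le (t s : ℝ≥0) (m : ℕ) : futureSigma N Z t s m ≤ mΩ :=
  sup_le ((h.measurable_count s).sub (h.measurable_count t)).comap_le
    (iSup₂_le fun l _ => (h.measurable_jump l).comap_le)

lemma indep_increment_jumps (t s : ℝ≥0) :
    Indep ((⨆ u : Iic t, MeasurableSpace.comap (N u) inferInstance) ⊔
        MeasurableSpace.comap (fun ω => N s ω - N t ω) inferInstance)
      (MeasurableSpace.comap (fun ω i => Z i ω) inferInstance) P := by
  have hi := h.indep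
  rw [IndepFun_iff_Indep] at hi
  have hN : ∀ u, Measurable[MeasurableSpace.comap (fun ω t => N t ω) inferInstance] (N u) :=
    fun u => (measurable_pi_apply u).comp (comap_measurable fun ω t => N t ω)
  refine indep_of_indep_of_le_left hi (sup_le (iSup_le fun u => (hN u).comap_le) ?_)
  exact (@Measurable.sub _ _ _ _ _ (_) _ _ (hN s) (hN t)).comap_le

/-- A regrouping of three independences: the counting process from the jumps, its past from its
increment, and the first `m` jumps from the rest. Fixing the number `m` avoids jumps with a random
index. -/
lemma indep_past_future [IsProbabilityMeasure P] {t s : ℝ≥0} (hts : t ≤ s) (m : ℕ) :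
    Indep (pastSigma N Z t m) (futureSigma N Z t s m) P := by
  have hZ : ∀ l, Measurable[MeasurableSpace.comap (fun ω i => Z i ω) inferInstance] (Z l) :=
    fun l => (measurable_pi_apply l).comp (comap_measurable fun ω i => Z i ω)
  refine indep_sup_sup (iSup_le fun u => (h.measurable_count u).comap_le)
    ((h.measurable_count s).sub (h.measurable_count t)).comap_le
    (iSup₂_le fun l _ => (h.measurable_jump l).comap_le)
    (iSup₂_le fun l _ => (h.measurable_jump l).comap_le) ?_
    (indep_past_increment h.measurable_count h.zero h.mono h.indep_increments hts) ?_
  · exact indep_of_indep_of_le_right (h.indep_increment_jumps t s)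
      (sup_le (iSup₂_le fun l _ => (hZ l).comap_le) (iSup₂_le fun l _ => (hZ l).comap_le))
  · exact indep_iSup_of_disjoint (fun l => (h.measurable_jump l).comap_le) h.indep_jumps.iIndep
      (Set.Iio_disjoint_Ici le_rfl)

lemma lintegral_pow_sum_jumps (R : ℝ≥0∞) (m k : ℕ) :
    ∫⁻ ω, R ^ (∑ i ∈ Finset.Ico m (m + k), Z i ω) ∂P = (∫⁻ ω, R ^ Z 0 ω ∂P) ^ k := by
  have hR : Measurable fun k : ℕ => R ^ k := measurable_from_top
  simp_rw [← Finset.prod_pow_eq_pow_sum]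
  rw [lintegral_prod_eq_prod_lintegral_of_indepFun _ (fun i ω => R ^ Z i ω)
    (h.indep_jumps.comp (fun _ k => R ^ k) fun _ => hR) (fun i => hR.comp (h.measurable_jump i))]
  have hi : ∀ i, ∫⁻ ω, R ^ Z i ω ∂P = ∫⁻ ω, R ^ Z 0 ω ∂P := fun i =>
    ((h.law_jumps i).comp hR).lintegral_eq
  simp [hi]

lemma lintegral_increment_mul_jumps (R : ℝ≥0∞) (t s : ℝ≥0) (m k : ℕ) :
    ∫⁻ ω, {ω | N s ω - N t ω = k}.indicator 1 ω * R ^ (∑ i ∈ Finset.Ico m (m + k), Z i ω) ∂P =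
      P {ω | N s ω - N t ω = k} * (∫⁻ ω, R ^ Z 0 ω ∂P) ^ k := by
  have hR : Measurable fun k : ℕ => R ^ k := measurable_from_top
  have hY : Measurable fun ω => N s ω - N t ω := (h.measurable_count s).sub (h.measurable_count t)
  have hZ : ∀ l, Measurable[MeasurableSpace.comap (fun ω i => Z i ω) inferInstance] (Z l) :=
    fun l => (measurable_pi_apply l).comp (comap_measurable fun ω i => Z i ω)
  rw [lintegral_mul_eq_lintegral_mul_lintegral_of_independent_measurableSpace
    hY.comap_le (measurable_pi_lambda _ h.measurable_jump).comap_le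
    (indep_of_indep_of_le_left (h.indep_increment_jumps t s) le_sup_right),
    h.lintegral_pow_sum_jumps,
    lintegral_indicator_one (s := {ω | N s ω - N t ω = k}) (hY (measurableSet_singleton k))]
  · exact @Measurable.indicator _ _ (_) _ _ _ _ (@measurable_const _ _ _ (_) _)
      ⟨{k}, measurableSet_singleton k, rfl⟩
  · exact hR.comp (@Finset.measurable_fun_sum _ _ _ _ _ _ (_) _ _ fun i _ => hZ i)

lemma tsum_law_increment_mul_pow {t s : ℝ≥0} (hts : t ≤ s) {ρ : ℝ≥0∞} (hρ : ρ ≤ 1) :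
    ∑' k, P {ω | N s ω - N t ω = k} * ρ ^ k =
      ENNReal.ofReal (Real.exp (-(lam * (s - t) * (1 - ρ.toReal)))) := by
  have hY : Measurable fun ω => N s ω - N t ω := (h.measurable_count s).sub (h.measurable_count t)
  have hP : ∀ k, P {ω | N s ω - N t ω = k} = poissonMeasure (lam * (s - t)) {k} := fun k => by
    rw [← h.law_increments t s hts, Measure.map_apply hY (measurableSet_singleton k)]
    rfl
  obtain ⟨x, hx, hρ''⟩ : ∃ x : ℝ, 0 ≤ x ∧ ρ = ENNReal.ofReal x :=
    ⟨ρ.toReal, ENNReal.toReal_nonneg, (ENNReal.ofReal_toReal (ne_top_of_le_ne_top ENNReal.one_ne_top hρ)).symm⟩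
  have hr : ((lam * (s - t) : ℝ≥0) : ℝ) = lam * (s - t) := by
    rw [NNReal.coe_mul, NNReal.coe_sub hts]
  have hexp := (NormedSpace.expSeries_div_hasSum_exp ((lam : ℝ) * (s - t) * x)).mul_left
    (Real.exp (-(lam * (s - t))))
  rw [← Real.exp_eq_exp_ℝ] at hexp
  rw [hρ'', ENNReal.toReal_ofReal hx]
  have : Real.exp (-(lam * (s - t) * (1 - x))) =
      Real.exp (-(lam * (s - t))) * Real.exp (lam * (s - t) * x) := by
    rw [← Real.exp_add]
    ring_nf
  have hst : (0 : ℝ) ≤ s - t := sub_nonneg.2 (NNReal.coe_le_coe.2 hts)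
  rw [this, ← hexp.tsum_eq, ENNReal.ofReal_tsum_of_nonneg (fun k => by positivity) hexp.summable]
  refine tsum_congr fun k => ?_
  rw [hP, poissonMeasure_singleton, hr, ← ENNReal.ofReal_pow hx, ← ENNReal.ofReal_mul (by positivity),
    _root_.mul_pow _ x]
  congr 1
  ring

end IsRegularCompound

lemma lintegral_exp_neg_sub_Ioi {b : ℝ} (hb : 0 < b) (t : ℝ) :
    ∫⁻ s in Ioi t, ENNReal.ofReal (Real.exp (-(b * (s - t)))) = ENNReal.ofReal (1 / b) := by
  have h1 : ∀ s, Real.exp (-(b * (s - t))) = Real.exp (b * t) * Real.exp (-b * s) := fun s => by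
    rw [← Real.exp_add]
    ring_nf
  have hint : IntegrableOn (fun s => Real.exp (-b * s)) (Ioi t) :=
    integrableOn_exp_mul_Ioi (neg_lt_zero.2 hb) t
  simp_rw [h1]
  rw [← ofReal_integral_eq_lintegral_ofReal (hint.const_mul _)
    (.of_forall fun s => by positivity), integral_const_mul, integral_exp_mul_Ioi (neg_lt_zero.2 hb)]
  congr 1
  rw [neg_div_neg_eq, ← mul_div_assoc, ← Real.exp_add]
  simp

/-- A family of random variables that is right-continuous in time is jointly measurable. -/
lemma measurable_uncurry_of_rightContinuous {Ω : Type*} [MeasurableSpace Ω] {N : ℝ≥0 → Ω → ℕ}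
    (hN : ∀ t, Measurable (N t))
    (hrc : ∀ ω t, ContinuousWithinAt (fun t => N t ω) (Ici t) t) :
    Measurable fun p : ℝ≥0 × Ω => N p.1 p.2 := by
  -- The time is replaced by the next point of the grid of mesh `1 / (n + 1)` to its right, so that
  -- only countably many times occur at each stage.
  refine measurable_of_tendsto_metrizable
    (f := fun (n : ℕ) (p : ℝ≥0 × Ω) => N ((⌊(n + 1) * p.1⌋₊ + 1) / (n + 1)) p.2) (fun n => ?_) ?_
  · have h1 : ∀ σ : ℕ → ℝ≥0, Measurable fun p : ℕ × Ω => N (σ p.1) p.2 := fun σ =>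
      measurable_from_prod_countable_right fun k => hN (σ k)
    have h2 : Measurable fun p : ℝ≥0 × Ω => (⌊((n : ℝ≥0) + 1) * p.1⌋₊, p.2) := by fun_prop
    have h3 := (h1 fun k => ((k : ℝ≥0) + 1) / ((n : ℝ≥0) + 1)).comp h2
    exact h3
  · rw [tendsto_pi_nhds]
    rintro ⟨t, ω⟩
    have hpos : ∀ n : ℕ, (0 : ℝ≥0) < n + 1 := fun n => by positivity
    have hlow : ∀ n : ℕ, t ≤ (⌊(n + 1) * t⌋₊ + 1) / (n + 1) := fun n => by
      rw [le_div_iff₀ (hpos n), mul_comm]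
      exact (Nat.lt_floor_add_one _).le
    have hup : ∀ n : ℕ, ((⌊(n + 1) * t⌋₊ + 1) / (n + 1) : ℝ≥0) ≤ t + 1 / (n + 1) := fun n => by
      rw [add_div]
      refine add_le_add_left ?_ _
      rw [div_le_iff₀ (hpos n), mul_comm]
      exact Nat.floor_le (zero_le)
    refine (hrc ω t).tendsto.comp (tendsto_nhdsWithin_iff.2 ⟨?_, .of_forall hlow⟩)
    refine tendsto_of_tendsto_of_tendsto_of_le_of_le tendsto_const_nhds ?_ hlow hup
    have := (tendsto_const_nhds (x := t)).add (tendsto_one_div_add_atTop_nhds_zero_nat (𝕜 := ℝ≥0))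
    simpa using this

lemma IsPast.measurable {Ω : Type*} [mΩ : MeasurableSpace Ω] {P : Measure Ω} {lam : ℝ≥0}
    {N : ℝ≥0 → Ω → ℕ} {Z : ℕ → Ω → ℕ} (h : IsRegularCompound P lam N Z) {t : ℝ≥0}
    {X : Ω → ℝ≥0∞} (hX : IsPast N Z t X) : Measurable X := by
  have h1 : X = fun ω => ∑' m, {ω | N t ω = m}.indicator X ω := by
    ext ω
    rw [tsum_eq_single (N t ω) fun m hm => indicator_of_notMem (fun h => hm h.symm) _]
    simp
  rw [h1]
  exact Measurable.tsum fun m => (hX m).mono (h.pastSigma_le t m) le_rfl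

lemma lintegral_pow_nat_le_one {Ω : Type*} [MeasurableSpace Ω] {P : Measure Ω}
    [IsProbabilityMeasure P] {Z₁ : Ω → ℕ} {R : ℝ≥0∞} (hR : R ≤ 1) : ∫⁻ ω, R ^ Z₁ ω ∂P ≤ 1 :=
  (lintegral_mono fun ω => pow_le_one₀ (zero_le) hR).trans_eq (by simp)

/-! ### Moments of the exponential functional. -/

namespace IsRegularCompound

variable {Ω : Type*} [mΩ : MeasurableSpace Ω] {P : Measure Ω} {lam : ℝ≥0} {N : ℝ≥0 → Ω → ℕ}
  {Z : ℕ → Ω → ℕ} (h : IsRegularCompound P lam N Z)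

include h

lemma measurable_compoundSum :
    Measurable fun p : ℝ × Ω => compoundSum N Z p.1.toNNReal p.2 := by
  have h1 : Measurable fun p : ℕ × Ω => ∑ i ∈ Finset.range p.1, Z i p.2 :=
    measurable_from_prod_countable_right fun k =>
      Finset.measurable_fun_sum (Finset.range k) fun i _ => h.measurable_jump i
  have h2 := measurable_uncurry_of_rightContinuous h.measurable_count h.right_cont
  have h3 : Measurable fun p : ℝ × Ω => (p.1.toNNReal, p.2) := by fun_prop
  exact h1.comp ((h2.comp h3).prodMk measurable_snd)

lemma measurable_pow_compoundSum (Q : ℝ≥0∞) :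
    Measurable (Function.uncurry fun (s : ℝ) ω => Q ^ compoundSum N Z s.toNNReal ω) :=
  (measurable_from_top (f := fun k : ℕ => Q ^ k)).comp h.measurable_compoundSum

lemma compoundSum_eq_add {t s : ℝ≥0} (hts : t ≤ s) (ω : Ω) : compoundSum N Z s ω =
    compoundSum N Z t ω + ∑ i ∈ Finset.Ico (N t ω) (N s ω), Z i ω :=
  (Finset.sum_range_add_sum_Ico _ (h.mono ω hts)).symm

variable [IsProbabilityMeasure P]

/-- Splitting by `m = N t` and by the increment `k` makes the range of jumps deterministic. Each
term then factors into past and future, and the sum over `k` is the Poisson generating function, the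
same for every `m`. -/
lemma lintegral_past_mul_increment {t s : ℝ≥0} (hts : t ≤ s) {Y : Ω → ℝ≥0∞}
    (hY : IsPast N Z t Y) {R : ℝ≥0∞} (hR : R ≤ 1) :
    ∫⁻ ω, Y ω * R ^ (∑ i ∈ Finset.Ico (N t ω) (N s ω), Z i ω) ∂P =
      (∫⁻ ω, Y ω ∂P) * ENNReal.ofReal
        (Real.exp (-(lam * (s - t) * (1 - (∫⁻ ω, R ^ Z 0 ω ∂P).toReal)))) := by
  set ρ := ∫⁻ ω, R ^ Z 0 ω ∂P
  have hYm : ∀ m, Measurable ({ω | N t ω = m}.indicator Y) := fun m =>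
    (hY m).mono (h.pastSigma_le t m) le_rfl
  have hsum : ∀ ω, Y ω = ∑' m, {ω | N t ω = m}.indicator Y ω := fun ω => by
    rw [tsum_eq_single (N t ω) fun m hm => indicator_of_notMem (fun h => hm h.symm) _]
    simp
  set G : ℕ → ℕ → Ω → ℝ≥0∞ := fun m k ω => {ω | N s ω - N t ω = k}.indicator 1 ω *
    R ^ (∑ i ∈ Finset.Ico m (m + k), Z i ω) with hG
  have hGf : ∀ m k, Measurable[futureSigma N Z t s m] (G m k) := by
    intro m k
    refine @Measurable.mul _ _ _ _ _ (_) _ _ ?_ ?_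
    · refine @Measurable.indicator _ _ (_) _ _ _ _ (@measurable_const _ _ _ (_) _) ?_
      have hle : MeasurableSpace.comap (fun ω => N s ω - N t ω) inferInstance ≤
        futureSigma N Z t s m := le_sup_left
      exact hle _ ⟨{k}, measurableSet_singleton k, rfl⟩
    · refine (measurable_from_top (f := fun k : ℕ => R ^ k)).comp
        (@Finset.measurable_fun_sum _ _ _ _ _ _ (_) _ _ fun i hi => ?_)
      have hle : MeasurableSpace.comap (Z i) inferInstance ≤ futureSigma N Z t s m :=
        le_sup_of_le_right (le_iSup₂_of_le i (Finset.mem_Ico.1 hi).1 le_rfl)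
      exact Measurable.mono (comap_measurable _) hle le_rfl
  have hGm : ∀ m k, Measurable (G m k) := fun m k =>
    (hGf m k).mono (h.futureSigma_le t s m) le_rfl
  have hpt : ∀ ω, Y ω * R ^ (∑ i ∈ Finset.Ico (N t ω) (N s ω), Z i ω) =
      ∑' m, ∑' k, {ω | N t ω = m}.indicator Y ω * G m k ω := by
    intro ω
    rw [tsum_eq_single (N t ω), tsum_eq_single (N s ω - N t ω)]
    · have hle : N t ω ≤ N s ω := h.mono ω hts
      simp [hG, Nat.add_sub_of_le hle]
    · intro k hk
      have : ω ∉ {ω | N s ω - N t ω = k} := fun h => hk h.symm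
      simp [hG, indicator_of_notMem this]
    · intro m hm
      have : ω ∉ {ω | N t ω = m} := fun h => hm h.symm
      simp [indicator_of_notMem this]
  have hterm : ∀ m k, ∫⁻ ω, {ω | N t ω = m}.indicator Y ω * G m k ω ∂P =
      (∫⁻ ω, {ω | N t ω = m}.indicator Y ω ∂P) * (P {ω | N s ω - N t ω = k} * ρ ^ k) := by
    intro m k
    rw [lintegral_mul_eq_lintegral_mul_lintegral_of_independent_measurableSpace
      (h.pastSigma_le t m) (h.futureSigma_le t s m) (h.indep_past_future hts m) (hY m) (hGf m k),
      h.lintegral_increment_mul_jumps]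
  have hrhs : ∫⁻ ω, Y ω ∂P = ∑' m, ∫⁻ ω, {ω | N t ω = m}.indicator Y ω ∂P := by
    rw [← lintegral_tsum fun m => (hYm m).aemeasurable]
    exact lintegral_congr hsum
  have hYG : ∀ m k, Measurable fun ω => {ω | N t ω = m}.indicator Y ω * G m k ω := fun m k =>
    (hYm m).mul (hGm m k)
  rw [lintegral_congr hpt, lintegral_tsum fun m =>
    (Measurable.tsum fun k => hYG m k).aemeasurable, hrhs,
    ← h.tsum_law_increment_mul_pow hts (lintegral_pow_nat_le_one hR), ← ENNReal.tsum_mul_right]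
  refine tsum_congr fun m => ?_
  rw [lintegral_tsum fun k => (hYG m k).aemeasurable, ← ENNReal.tsum_mul_left]
  exact tsum_congr fun k => hterm m k

lemma lintegral_past_mul_pow {t s : ℝ≥0} (hts : t ≤ s) {X : Ω → ℝ≥0∞}
    (hX : IsPast N Z t X) {R : ℝ≥0∞} (hR : R ≤ 1) :
    ∫⁻ ω, X ω * R ^ compoundSum N Z s ω ∂P =
      (∫⁻ ω, X ω * R ^ compoundSum N Z t ω ∂P) * ENNReal.ofReal
        (Real.exp (-(lam * (s - t) * (1 - (∫⁻ ω, R ^ Z 0 ω ∂P).toReal)))) := by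
  rw [← h.lintegral_past_mul_increment hts (hX.mul_pow R) hR]
  refine lintegral_congr fun ω => ?_
  rw [h.compoundSum_eq_add hts, pow_add, mul_assoc]

/-- The arbitrary past factor `X` is what carries the induction: after Tonelli, the outermost `Q ^
S_s` is absorbed into it, so that the hypothesis at time `s` produces `Q ^ (n + 1)`. Going back from
`s` to `t` costs an exponential of rate `b (n + 1)`, whose integral over `s > t` is the new factor.
-/
lemma lintegral_past_mul_iterTail {Q : ℝ≥0∞} (hQ : Q ≤ 1) {b : ℕ → ℝ}
    (hb : ∀ n, b n = lam * (1 - (∫⁻ ω, (Q ^ n) ^ Z 0 ω ∂P).toReal))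
    (hpos : ∀ n, 0 < b (n + 1)) (n : ℕ) :
    ∀ (t : ℝ), 0 ≤ t → ∀ X : Ω → ℝ≥0∞, IsPast N Z t.toNNReal X →
      ∫⁻ ω, X ω * iterTail (fun s => Q ^ compoundSum N Z s.toNNReal ω) n t ∂P =
        (∫⁻ ω, X ω * (Q ^ n) ^ compoundSum N Z t.toNNReal ω ∂P) *
          ∏ k ∈ Finset.range n, ENNReal.ofReal (1 / b (k + 1)) := by
  induction n with
  | zero => intro t _ X _; simp [iterTail]
  | succ n ih =>
    intro t ht X hX
    have hXm := hX.measurable h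
    have hf := h.measurable_pow_compoundSum Q
    have hfK : Measurable fun p : ℝ × Ω => Q ^ compoundSum N Z p.1.toNNReal p.2 *
        iterTail (fun s => Q ^ compoundSum N Z s.toNNReal p.2) n p.1 :=
      hf.mul (measurable_iterTail_prod hf n)
    calc ∫⁻ ω, X ω * iterTail (fun s => Q ^ compoundSum N Z s.toNNReal ω) (n + 1) t ∂P
        = ∫⁻ ω, (∫⁻ s in Ioi t, X ω * (Q ^ compoundSum N Z s.toNNReal ω *
            iterTail (fun s => Q ^ compoundSum N Z s.toNNReal ω) n s)) ∂P := by
          refine lintegral_congr fun ω => ?_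
          rw [iterTail, lintegral_const_mul]
          exact hfK.comp (measurable_id.prodMk (measurable_const (a := ω)))
      _ = ∫⁻ s in Ioi t, (∫⁻ ω, X ω * (Q ^ compoundSum N Z s.toNNReal ω *
            iterTail (fun s => Q ^ compoundSum N Z s.toNNReal ω) n s) ∂P) := by
          refine lintegral_lintegral_swap (Measurable.aemeasurable ?_)
          have h1 : Measurable fun p : Ω × ℝ => X p.1 := hXm.comp measurable_fst
          have h2 : Measurable fun p : Ω × ℝ => (p.2, p.1) := measurable_swap
          have h3 := h1.mul (hfK.comp h2)
          exact h3
      _ = ∫⁻ s in Ioi t, ((∫⁻ ω, X ω * (Q ^ (n + 1)) ^ compoundSum N Z t.toNNReal ω ∂P) *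
            ∏ k ∈ Finset.range n, ENNReal.ofReal (1 / b (k + 1))) *
            ENNReal.ofReal (Real.exp (-(b (n + 1) * (s - t)))) := by
          refine setLIntegral_congr_fun measurableSet_Ioi fun s hs => ?_
          have hts : t ≤ s := le_of_lt hs
          have hs0 : 0 ≤ s := ht.trans hts
          have hts' : t.toNNReal ≤ s.toNNReal := Real.toNNReal_le_toNNReal hts
          have h1 := ih s hs0 _ ((hX.mono h.mono hts').mul_pow Q)
          have h0 : ∀ (g₁ g₂ : Ω → ℝ≥0∞), ∫⁻ ω, X ω * (g₁ ω * g₂ ω) ∂P =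
              ∫⁻ ω, X ω * g₁ ω * g₂ ω ∂P := fun g₁ g₂ =>
            lintegral_congr fun ω => (mul_assoc _ _ _).symm
          rw [← h0] at h1
          have h2 : ∀ ω, X ω * (Q ^ compoundSum N Z s.toNNReal ω *
              (Q ^ n) ^ compoundSum N Z s.toNNReal ω) =
              X ω * (Q ^ (n + 1)) ^ compoundSum N Z s.toNNReal ω := fun ω => by
            rw [← mul_pow, pow_succ']
          have h3 := h.lintegral_past_mul_pow hts' hX (pow_le_one₀ zero_le hQ : Q ^ (n + 1) ≤ 1)
          rw [Real.coe_toNNReal _ ht, Real.coe_toNNReal _ hs0, mul_right_comm (lam : ℝ), ← hb] at h3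
          rw [h1, ← h0, lintegral_congr h2, h3, mul_right_comm]
      _ = (∫⁻ ω, X ω * (Q ^ (n + 1)) ^ compoundSum N Z t.toNNReal ω ∂P) *
            ∏ k ∈ Finset.range (n + 1), ENNReal.ofReal (1 / b (k + 1)) := by
          rw [lintegral_const_mul _ (by fun_prop), lintegral_exp_neg_sub_Ioi (hpos n),
            Finset.prod_range_succ, mul_assoc]

/-- The moments of the exponential functional. -/
theorem lintegral_tail_pow {Q : ℝ≥0∞} (hQ : Q ≤ 1) {b : ℕ → ℝ}
    (hb : ∀ n, b n = lam * (1 - (∫⁻ ω, (Q ^ n) ^ Z 0 ω ∂P).toReal))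
    (hpos : ∀ n, 0 < b (n + 1)) (n : ℕ) :
    ∫⁻ ω, (∫⁻ s in Ioi (0 : ℝ), Q ^ compoundSum N Z s.toNNReal ω) ^ n ∂P =
      n.factorial * ∏ k ∈ Finset.range n, ENNReal.ofReal (1 / b (k + 1)) := by
  have hf := h.measurable_pow_compoundSum Q
  have h1 := h.lintegral_past_mul_iterTail hQ hb hpos n 0 le_rfl (fun _ => 1) (isPast_const 1)
  simp only [one_mul, Real.toNNReal_zero, compoundSum, h.zero, Finset.range_zero, Finset.sum_empty,
    pow_zero, lintegral_const, measure_univ] at h1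
  have h2 : ∀ ω, (∫⁻ s in Ioi (0 : ℝ), Q ^ compoundSum N Z s.toNNReal ω) ^ n =
      n.factorial * iterTail (fun s => Q ^ compoundSum N Z s.toNNReal ω) n 0 := fun ω =>
    tail_pow_eq (hf.comp (measurable_id.prodMk (measurable_const (a := ω)))) n 0
  rw [lintegral_congr h2, lintegral_const_mul]
  · exact congrArg _ h1
  · exact (measurable_iterTail_prod hf n).comp ((measurable_const (a := (0 : ℝ))).prodMk measurable_id)

end IsRegularCompound

/-! ### Signed mixtures of exponential laws. -/

section Mixture

lemma summable_max_mul {d e : ℕ → ℝ} (hd : Summable d) (he0 : ∀ j, 0 ≤ e j) (he1 : ∀ j, e j ≤ 1) :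
    Summable fun j => max (d j) 0 * e j :=
  hd.abs.of_norm_bounded fun j => by
    rw [norm_mul, Real.norm_of_nonneg (he0 j), Real.norm_of_nonneg (le_max_right _ _)]
    exact (mul_le_of_le_one_right (le_max_right _ _) (he1 j)).trans
      (max_le (le_abs_self _) (abs_nonneg _))

lemma tsum_ofReal_mul {d e : ℕ → ℝ} (hd : Summable d) (he0 : ∀ j, 0 ≤ e j) (he1 : ∀ j, e j ≤ 1) :
    ∑' j, ENNReal.ofReal (d j) * ENNReal.ofReal (e j) =
      ENNReal.ofReal (∑' j, max (d j) 0 * e j) := by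
  rw [ENNReal.ofReal_tsum_of_nonneg (fun j => mul_nonneg (le_max_right _ _) (he0 j))
    (summable_max_mul hd he0 he1)]
  refine tsum_congr fun j => ?_
  rw [ENNReal.ofReal_mul (le_max_right _ _)]
  congr 1
  rcases le_total 0 (d j) with h | h
  · rw [max_eq_left h]
  · rw [max_eq_right h, ENNReal.ofReal_of_nonpos h, ENNReal.ofReal_zero]

lemma tsum_max_mul_eq {d e : ℕ → ℝ} (hd : Summable d) (he0 : ∀ j, 0 ≤ e j) (he1 : ∀ j, e j ≤ 1) :
    ∑' j, max (d j) 0 * e j = ∑' j, d j * e j + ∑' j, max (-d j) 0 * e j := by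
  have h1 := summable_max_mul hd he0 he1
  have h2 := summable_max_mul hd.neg he0 he1
  have h3 : ∀ j, d j * e j = max (d j) 0 * e j - max (-d j) 0 * e j := fun j => by
    rcases le_total 0 (d j) with h | h
    · rw [max_eq_left h, max_eq_right (neg_nonpos.2 h)]
      ring
    · rw [max_eq_right h, max_eq_left (neg_nonneg.2 h)]
      ring
  rw [tsum_congr h3, h1.tsum_sub h2]
  ring

/-- The mixture of exponential laws with rates `θ / q ^ j` and weights the positive parts
of `d j`. -/
noncomputable def expMixture (d : ℕ → ℝ) (θ q : ℝ) : Measure ℝ :=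
  Measure.sum fun j => ENNReal.ofReal (d j) • expMeasure (θ / q ^ j)

variable {d : ℕ → ℝ} {θ q : ℝ}

lemma ae_nonneg_expMixture : ∀ᵐ x ∂(expMixture d θ q), 0 ≤ x := by
  rw [expMixture, Measure.ae_sum_iff' (measurableSet_Ici : MeasurableSet {x : ℝ | 0 ≤ x})]
  exact fun j => Measure.ae_smul_measure (ae_nonneg_expMeasure _) _

lemma expMixture_Ioi (hd : Summable d) (hθ : 0 < θ) (hq0 : 0 < q) {x : ℝ} (hx : 0 ≤ x) :
    expMixture d θ q (Ioi x) =
      ENNReal.ofReal (∑' j, max (d j) 0 * Real.exp (-(θ / q ^ j * x))) := by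
  rw [← tsum_ofReal_mul hd (fun j => (Real.exp_pos _).le)
    (fun j => Real.exp_le_one_iff.2 (neg_nonpos.2 (by positivity))), expMixture,
    Measure.sum_apply _ measurableSet_Ioi]
  refine tsum_congr fun j => ?_
  rw [Measure.smul_apply, expMeasure_Ioi (by positivity) hx, smul_eq_mul]

/-- Rates in geometric progression make the `n`-th moment a generating function evaluated at `q ^
n`, the form in which the recurrence delivers it. -/
lemma lintegral_pow_expMixture (hd : Summable d) (hθ : 0 < θ) (hq0 : 0 < q) (hq1 : q ≤ 1) (n : ℕ) :
    ∫⁻ x, ENNReal.ofReal x ^ n ∂(expMixture d θ q) =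
      ENNReal.ofReal (n.factorial * (1 / θ) ^ n * ∑' j, max (d j) 0 * (q ^ n) ^ j) := by
  rw [ENNReal.ofReal_mul (by positivity), ← tsum_ofReal_mul hd (fun j => by positivity)
    (fun j => pow_le_one₀ (by positivity) (pow_le_one₀ hq0.le hq1)), expMixture,
    lintegral_sum_measure, ← ENNReal.tsum_mul_left]
  refine tsum_congr fun j => ?_
  have h1 : (n.factorial : ℝ) * (1 / (θ / q ^ j)) ^ n =
      n.factorial * (1 / θ) ^ n * (q ^ n) ^ j := by
    rw [one_div_div, div_pow, div_pow, one_pow, ← pow_mul, ← pow_mul, mul_comm n j]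
    ring
  rw [lintegral_smul_measure, lintegral_pow_expMeasure (by positivity), smul_eq_mul, h1,
    ENNReal.ofReal_mul (by positivity), mul_left_comm]

lemma isFiniteMeasure_expMixture (hd : Summable d) (hθ : 0 < θ) (hq0 : 0 < q) (hq1 : q ≤ 1) :
    IsFiniteMeasure (expMixture d θ q) := by
  refine ⟨?_⟩
  have h := lintegral_pow_expMixture hd hθ hq0 hq1 0
  simp only [pow_zero, lintegral_const, one_mul] at h
  rw [h]
  exact ENNReal.ofReal_lt_top

/-- A law on the half-line whose moments are those of a signed mixture of exponential laws
has the tails of that mixture. -/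
theorem mul_tail_eq_of_moments {μ : Measure ℝ} [IsFiniteMeasure μ] (hμ : ∀ᵐ x ∂μ, 0 ≤ x)
    (hd : Summable d) (hθ : 0 < θ) (hq0 : 0 < q) (hq1 : q ≤ 1) {D : ℝ} (hD : 0 ≤ D) {M : ℕ → ℝ}
    (hM : ∀ n, 0 ≤ M n) (hμM : ∀ n : ℕ, ∫⁻ x, ENNReal.ofReal x ^ n ∂μ = ENNReal.ofReal (M n))
    (hMd : ∀ n : ℕ, D * M n = n.factorial * (1 / θ) ^ n * ∑' j, d j * (q ^ n) ^ j) {x : ℝ}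
    (hx : 0 ≤ x) :
    D * μ.real (Ioi x) = ∑' j, d j * Real.exp (-(θ / q ^ j * x)) := by
  have hfin1 := isFiniteMeasure_expMixture hd hθ hq0 hq1
  have hfin2 := isFiniteMeasure_expMixture hd.neg hθ hq0 hq1
  have hfin3 : IsFiniteMeasure (ENNReal.ofReal D • μ) := μ.smul_finite ENNReal.ofReal_ne_top
  have hnn : ∀ (e : ℕ → ℝ), (∀ j, 0 ≤ e j) → ∀ c : ℕ → ℝ, 0 ≤ ∑' j, max (c j) 0 * e j :=
    fun e he c => tsum_nonneg fun j => mul_nonneg (le_max_right _ _) (he j)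
  have hpow0 : ∀ n j : ℕ, 0 ≤ (q ^ n) ^ j := fun n j => by positivity
  have hpow1 : ∀ n j : ℕ, (q ^ n) ^ j ≤ 1 := fun n j =>
    pow_le_one₀ (by positivity) (pow_le_one₀ hq0.le hq1)
  -- Each mixture keeps only the positive part of its weights, so this is the signed identity
  -- rewritten between genuine measures. The moment bound needs only the total positive weight.
  have heq : expMixture d θ q = ENNReal.ofReal D • μ + expMixture (fun j => -d j) θ q := by
    refine measure_eq_of_moments_eq ae_nonneg_expMixture
      (ae_add_measure_iff.2 ⟨Measure.ae_smul_measure hμ _, ae_nonneg_expMixture⟩) (fun n => ?_)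
      (C := ∑' j, max (d j) 0 * 1) (R := 1 / θ)
      (hnn (fun _ => 1) (fun _ => zero_le_one) d) (by positivity) (fun n => ?_)
    · rw [lintegral_add_measure, lintegral_smul_measure, lintegral_pow_expMixture hd hθ hq0 hq1,
        lintegral_pow_expMixture hd.neg hθ hq0 hq1, hμM, smul_eq_mul, ← ENNReal.ofReal_mul hD,
        ← ENNReal.ofReal_add (mul_nonneg hD (hM n))
          (mul_nonneg (by positivity) (hnn _ (hpow0 n) _)), hMd,
        tsum_max_mul_eq hd (hpow0 n) (hpow1 n), mul_add]
    · rw [lintegral_pow_expMixture hd hθ hq0 hq1]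
      refine ENNReal.ofReal_le_ofReal ?_
      have h1 : ∑' j, max (d j) 0 * (q ^ n) ^ j ≤ ∑' j, max (d j) 0 * 1 :=
        (summable_max_mul hd (hpow0 n) (hpow1 n)).tsum_le_tsum
          (fun j => mul_le_mul_of_nonneg_left (hpow1 n j) (le_max_right _ _))
          (summable_max_mul hd (fun _ => zero_le_one) fun _ => le_rfl)
      calc n.factorial * (1 / θ) ^ n * ∑' j, max (d j) 0 * (q ^ n) ^ j
          ≤ n.factorial * (1 / θ) ^ n * ∑' j, max (d j) 0 * 1 :=
            mul_le_mul_of_nonneg_left h1 (by positivity)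
        _ = (∑' j, max (d j) 0 * 1) * n.factorial * (1 / θ) ^ n := by ring
  have he0 : ∀ j, 0 ≤ Real.exp (-(θ / q ^ j * x)) := fun j => (Real.exp_pos _).le
  have he1 : ∀ j, Real.exp (-(θ / q ^ j * x)) ≤ 1 := fun j =>
    Real.exp_le_one_iff.2 (neg_nonpos.2 (by positivity))
  have h := congrArg (fun ρ : Measure ℝ => ρ (Ioi x)) heq
  simp only [Measure.add_apply, Measure.smul_apply, smul_eq_mul] at h
  rw [expMixture_Ioi hd hθ hq0 hx, expMixture_Ioi hd.neg hθ hq0 hx, ← ofReal_measureReal,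
    ← ENNReal.ofReal_mul hD, ← ENNReal.ofReal_add (mul_nonneg hD measureReal_nonneg)
      (hnn _ he0 _), ENNReal.ofReal_eq_ofReal_iff (hnn _ he0 _)
      (add_nonneg (mul_nonneg hD measureReal_nonneg) (hnn _ he0 _)),
    tsum_max_mul_eq hd he0 he1] at h
  linarith

end Mixture

/-! ### Generating function of the jump law. -/

section Jumps

variable {Ω : Type*} [MeasurableSpace Ω] {P : Measure Ω} [IsProbabilityMeasure P] {Z₁ : Ω → ℕ}

lemma hasSum_prob_eq (hZ : Measurable Z₁) : HasSum (fun k => P.real {ω | Z₁ ω = k}) 1 := by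
  have h1 : ∑' k, P {ω | Z₁ ω = k} = 1 := by
    have h2 := lintegral_countable' (μ := P.map Z₁) fun _ => 1
    have := Measure.isProbabilityMeasure_map (μ := P) hZ.aemeasurable
    rw [lintegral_one, measure_univ] at h2
    rw [h2]
    refine tsum_congr fun k => ?_
    rw [one_mul, Measure.map_apply hZ (measurableSet_singleton k)]
    rfl
  have h3 := ENNReal.hasSum_toReal (f := fun k => P {ω | Z₁ ω = k}) (by simp [h1])
  rwa [← ENNReal.tsum_toReal_eq (fun k => measure_ne_top _ _), h1, ENNReal.toReal_one] at h3

lemma prob_one_le_eq (hZ : Measurable Z₁) :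
    P.real {ω | 1 ≤ Z₁ ω} = 1 - P.real {ω | Z₁ ω = 0} := by
  have h : {ω | 1 ≤ Z₁ ω} = {ω | Z₁ ω = 0}ᶜ := by
    ext ω
    simp [Nat.one_le_iff_ne_zero]
  have hm : MeasurableSet {ω | Z₁ ω = 0} := hZ (measurableSet_singleton 0)
  rw [h, probReal_compl_eq_one_sub hm]

lemma hasSum_prob_pos (hZ : Measurable Z₁) :
    HasSum (fun k => if k = 0 then 0 else P.real {ω | Z₁ ω = k}) (P.real {ω | 1 ≤ Z₁ ω}) := by
  have h := (hasSum_prob_eq (P := P) hZ).update 0 0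
  have h1 : (0 : ℝ) - P.real {ω | Z₁ ω = 0} + 1 = P.real {ω | 1 ≤ Z₁ ω} := by
    rw [prob_one_le_eq hZ]
    ring
  rw [h1] at h
  refine h.congr_fun fun k => ?_
  rw [Function.update_apply]

/-- The bridge between the two sides: at `y = q ^ n` the left side is the exponent from the moments,
divided by the intensity, and the right side is a factor from `generating_eq_prod`. -/
lemma one_sub_lintegral_pow (hZ : Measurable Z₁) {y : ℝ} (hy0 : 0 ≤ y) (hy1 : y ≤ 1) :
    1 - (∫⁻ ω, ENNReal.ofReal y ^ Z₁ ω ∂P).toReal = P.real {ω | 1 ≤ Z₁ ω} -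
      ∑' k, (if k = 0 then 0 else P.real {ω | Z₁ ω = k}) * y ^ k := by
  have hint : (∫⁻ ω, ENNReal.ofReal y ^ Z₁ ω ∂P).toReal = ∑' k, P.real {ω | Z₁ ω = k} * y ^ k := by
    have h1 : ∫⁻ ω, ENNReal.ofReal y ^ Z₁ ω ∂P =
        ∑' k, ENNReal.ofReal (P.real {ω | Z₁ ω = k} * y ^ k) := by
      rw [← lintegral_map (f := fun k : ℕ => ENNReal.ofReal y ^ k) measurable_from_top hZ,
        lintegral_countable']
      refine tsum_congr fun k => ?_
      rw [Measure.map_apply hZ (measurableSet_singleton k), ENNReal.ofReal_mul measureReal_nonneg,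
        ofReal_measureReal, ENNReal.ofReal_pow hy0, mul_comm]
      rfl
    have hs := summable_mul_pow_of_summable (hasSum_prob_eq (P := P) hZ).summable hy0 hy1
    rw [h1, ← ENNReal.ofReal_tsum_of_nonneg (fun k => by positivity) hs,
      ENNReal.toReal_ofReal (tsum_nonneg fun k => by positivity)]
  have hs := summable_mul_pow_of_summable (hasSum_prob_eq (P := P) hZ).summable hy0 hy1
  have ht := summable_mul_pow_of_summable (hasSum_prob_pos (P := P) hZ).summable hy0 hy1
  rw [hint, hs.tsum_eq_zero_add, ht.tsum_eq_zero_add, prob_one_le_eq hZ]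
  simp
  ring

end Jumps

/-! ### Removal of the exceptional null set. -/

section Regularization

variable {Ω : Type*} [MeasurableSpace Ω] {P : Measure Ω} {lam : ℝ≥0} {N : ℝ≥0 → Ω → ℕ}
  {Z : ℕ → Ω → ℕ}

/-- A Poisson process can be modified on a null set so that all its paths are regular. -/
lemma exists_isRegularCompound (hN : IsPoissonProcess P lam N) (hZ : ∀ i, Measurable (Z i))
    (hZ_indep : iIndepFun Z P) (hZ_law : ∀ i, IdentDistrib (Z i) (Z 0) P P)
    (hNZ : IndepFun (fun ω t => N t ω) (fun ω i => Z i ω) P) :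
    ∃ N' : ℝ≥0 → Ω → ℕ, IsRegularCompound P lam N' Z ∧ ∀ᵐ ω ∂P, ∀ t, N t ω = N' t ω := by
  classical
  have hgood := hN.zero.and hN.paths
  -- Path regularity need not be a measurable event, so `G` is the complement of a measurable hull
  -- of the bad set. Off `G` the process is replaced by zero.
  obtain ⟨G, hG, hGm, hGP⟩ : ∃ G : Set Ω, (∀ ω ∈ G, N 0 ω = 0 ∧ Monotone (fun t => N t ω) ∧
      ∀ t, ContinuousWithinAt (fun t => N t ω) (Ici t) t) ∧ MeasurableSet G ∧ ∀ᵐ ω ∂P, ω ∈ G := by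
    refine ⟨(toMeasurable P {ω | ¬ (N 0 ω = 0 ∧ Monotone (fun t => N t ω) ∧
      ∀ t, ContinuousWithinAt (fun t => N t ω) (Ici t) t)})ᶜ, fun ω hω => ?_,
      (measurableSet_toMeasurable _ _).compl, ?_⟩
    · by_contra hcon
      exact hω (subset_toMeasurable _ _ hcon)
    · rw [ae_iff]
      simp only [mem_compl_iff, not_not, ofPred_mem_eq, measure_toMeasurable]
      exact hgood
  have hae : ∀ᵐ ω ∂P, ∀ t, N t ω = if ω ∈ G then N t ω else 0 :=
    hGP.mono fun ω hω t => (if_pos hω).symm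
  refine ⟨fun t ω => if ω ∈ G then N t ω else 0, ?_, hae⟩
  refine
    { measurable_count := fun t => Measurable.ite hGm (hN.measurable t) measurable_const
      zero := fun ω => ?_
      mono := fun ω => ?_
      right_cont := fun ω => ?_
      indep_increments := fun n t ht => (hN.indep_increments n t ht).congr fun i =>
        hae.mono fun ω hω => ?_
      law_increments := fun s t hst => ?_
      measurable_jump := hZ
      indep_jumps := hZ_indep
      law_jumps := hZ_law
      indep := hNZ.congr (hae.mono fun ω hω => funext hω) (Filter.EventuallyEq.refl _ _) }
  · split_ifs with hω
    · exact (hG ω hω).1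
    · rfl
  · split_ifs with hω
    · exact (hG ω hω).2.1
    · exact monotone_const
  · split_ifs with hω
    · exact (hG ω hω).2.2
    · exact fun t => continuousWithinAt_const
  · simp only [← hω]
  · rw [← hN.law_increments s t hst]
    refine Measure.map_congr (hae.mono fun ω hω => ?_)
    simp only [← hω]

lemma expFunctional_zero_eq {Ω : Type*} {q : ℝ} (hq0 : 0 ≤ q) (S : ℝ≥0 → Ω → ℕ) (ω : Ω) :
    expFunctional q 0 S ω = ∫⁻ s in Ioi (0 : ℝ), ENNReal.ofReal q ^ S s.toNNReal ω := by
  refine lintegral_congr fun s => ?_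
  rw [zero_mul, add_zero, Real.rpow_natCast, ENNReal.ofReal_pow hq0]

end Regularization

/-! ### The tail formula and the theorem. -/

namespace IsRegularCompound

/-- The tail of the law of the exponential functional. -/
theorem mul_tail_expFunctional {Ω : Type*} [MeasurableSpace Ω] {P : Measure Ω}
    [IsProbabilityMeasure P] {lam : ℝ≥0} (hlam : 0 < lam) {N : ℝ≥0 → Ω → ℕ} {Z : ℕ → Ω → ℕ}
    (h : IsRegularCompound P lam N Z) (hZ_pos : 0 < P.real {ω | 1 ≤ Z 0 ω}) {q : ℝ} (hq0 : 0 < q)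
    (hq1 : q < 1) {x : ℝ} (hx : 0 ≤ x) :
    (∑' j, coeff P (Z 0) q j * q ^ j) *
        (1 - P.real {ω | expFunctional q 0 (compoundSum N Z) ω ≤ ENNReal.ofReal x}) =
      ∑' j, coeff P (Z 0) q j * q ^ j *
        Real.exp (-(lam * P.real {ω | 1 ≤ Z 0 ω} / q ^ j * x)) := by
  set p := P.real {ω | 1 ≤ Z 0 ω} with hp
  set a : ℕ → ℝ := fun k => if k = 0 then 0 else P.real {ω | Z 0 ω = k} with ha_def
  set d : ℕ → ℝ := fun j => coeff P (Z 0) q j * q ^ j with hd_def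
  set D := ∑' j, d j with hD
  have hlam' : (0 : ℝ) < lam := hlam
  have hZm := h.measurable_jump 0
  have ha : ∀ k, 0 ≤ a k := fun k => by
    simp only [ha_def]
    split_ifs
    exacts [le_rfl, measureReal_nonneg]
  have ha0 : a 0 = 0 := if_pos rfl
  have hap : HasSum a p := hasSum_prob_pos hZm
  have hrec := coeff_mul_pow_recurrence P (Z 0) hq0 hq1 hZ_pos
  have hds : Summable d := summable_of_recurrence hq0 hq1 hZ_pos ha ha0 hap hrec
  have hDpos : 0 < D := tsum_pos_of_recurrence hq0 hq1 hZ_pos ha ha0 hap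
    (by simp [hd_def, coeff_zero]) hrec
  set Q := ENNReal.ofReal q with hQ
  have hQ1 : Q ≤ 1 := ENNReal.ofReal_le_one.2 hq1.le
  set b : ℕ → ℝ := fun n => lam * (1 - (∫⁻ ω, (Q ^ n) ^ Z 0 ω ∂P).toReal) with hb_def
  have hb : ∀ n, b n = lam * (p - ∑' k, a k * (q ^ n) ^ k) := fun n => by
    simp only [hb_def]
    rw [hQ, ← ENNReal.ofReal_pow hq0.le, one_sub_lintegral_pow hZm (by positivity)
      (pow_le_one₀ hq0.le hq1.le)]
  have hbpos : ∀ n, 0 < b (n + 1) := fun n => by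
    rw [hb]
    have h1 := le_sub_tsum_mul_pow ha ha0 hap (pow_pos hq0 (n + 1)).le
      (pow_le_one₀ hq0.le hq1.le)
    have h2 : q ^ (n + 1) < 1 := pow_lt_one₀ hq0.le hq1 (by omega)
    exact mul_pos hlam' ((mul_pos hZ_pos (by linarith)).trans_le h1)
  set I : Ω → ℝ≥0∞ := fun ω => ∫⁻ s in Ioi (0 : ℝ), Q ^ compoundSum N Z s.toNNReal ω with hI
  have hIm : Measurable I := (h.measurable_pow_compoundSum Q).lintegral_prod_left'
  set M : ℕ → ℝ := fun n => n.factorial * ∏ k ∈ Finset.range n, (1 / b (k + 1)) with hM_def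
  have hM0 : ∀ n, 0 ≤ M n := fun n =>
    mul_nonneg (by positivity) (Finset.prod_nonneg fun k _ => (one_div_pos.2 (hbpos k)).le)
  have hImom : ∀ n : ℕ, ∫⁻ ω, I ω ^ n ∂P = ENNReal.ofReal (M n) := fun n => by
    rw [h.lintegral_tail_pow hQ1 (fun _ => rfl) hbpos n, ENNReal.ofReal_mul (by positivity),
      ENNReal.ofReal_natCast,
      ENNReal.ofReal_prod_of_nonneg fun k _ => (one_div_pos.2 (hbpos k)).le]
  -- The first moment is finite; this lets `toReal` replace the extended functional in moments and
  -- probabilities.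
  have hIfin : ∀ᵐ ω ∂P, I ω < ∞ := by
    refine ae_lt_top hIm ?_
    have h1 := hImom 1
    simp only [pow_one] at h1
    rw [h1]
    exact ENNReal.ofReal_ne_top
  have hRm : Measurable fun ω => (I ω).toReal := hIm.ennreal_toReal
  set μ := P.map fun ω => (I ω).toReal with hμ_def
  have hμprob : IsProbabilityMeasure μ := Measure.isProbabilityMeasure_map hRm.aemeasurable
  have hμ0 : ∀ᵐ x ∂μ, 0 ≤ x := by
    rw [hμ_def, ae_map_iff hRm.aemeasurable (measurableSet_Ici : MeasurableSet {x : ℝ | 0 ≤ x})]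
    exact .of_forall fun ω => ENNReal.toReal_nonneg
  have hμM : ∀ n : ℕ, ∫⁻ x, ENNReal.ofReal x ^ n ∂μ = ENNReal.ofReal (M n) := fun n => by
    rw [hμ_def, lintegral_map (by fun_prop) hRm, ← hImom]
    exact lintegral_congr_ae (hIfin.mono fun ω hω => by
      simp only [ENNReal.ofReal_toReal hω.ne])
  have hMd : ∀ n : ℕ, D * M n =
      n.factorial * (1 / (lam * p)) ^ n * ∑' j, d j * (q ^ n) ^ j := fun n => by
    have h1 := generating_eq_prod hq0 hq1 hap hrec hds n
    have h2 : ∏ k ∈ Finset.range n, b (k + 1) =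
        lam ^ n * ∏ k ∈ Finset.range n, (p - ∑' i, a i * (q ^ (k + 1)) ^ i) := by
      simp_rw [hb]
      rw [Finset.prod_mul_distrib, Finset.prod_const, Finset.card_range]
    have h3 : 0 < ∏ k ∈ Finset.range n, b (k + 1) := Finset.prod_pos fun k _ => hbpos k
    -- Here the denominator of the moment cancels against the product from the functional equation.
    have h4 : (lam * p) ^ n * D = (∏ k ∈ Finset.range n, b (k + 1)) * ∑' j, d j * (q ^ n) ^ j := by
      rw [h2, mul_pow, mul_assoc, h1, mul_assoc]
    have h5 : 0 < (lam * p) ^ n := pow_pos (mul_pos hlam' hZ_pos) n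
    simp only [hM_def]
    rw [Finset.prod_div_distrib, Finset.prod_const_one, div_pow, one_pow]
    field_simp
    linear_combination h4
  have hfinal := mul_tail_eq_of_moments hμ0 hds (mul_pos hlam' hZ_pos) hq0 hq1.le hDpos.le hM0 hμM
    hMd hx
  have hprob : P.real {ω | expFunctional q 0 (compoundSum N Z) ω ≤ ENNReal.ofReal x} =
      μ.real (Iic x) := by
    rw [hμ_def, map_measureReal_apply hRm measurableSet_Iic]
    refine measureReal_congr (hIfin.mono fun ω hω => propext ?_)
    change expFunctional q 0 (compoundSum N Z) ω ≤ ENNReal.ofReal x ↔ (I ω).toReal ≤ x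
    rw [expFunctional_zero_eq hq0.le, ENNReal.le_ofReal_iff_toReal_le hω.ne hx]
  rw [hprob, ← hfinal, ← compl_Ioi, probReal_compl_eq_one_sub measurableSet_Ioi, sub_sub_cancel]

end IsRegularCompound

end IVS

theorem mainTheorem9 {Ω : Type*} [MeasurableSpace Ω] (P : Measure Ω) [IsProbabilityMeasure P]
    (lam : ℝ≥0) (hlam : 0 < lam)
    (N : ℝ≥0 → Ω → ℕ) (hN : IVS.IsPoissonProcess P lam N)
    (Z : ℕ → Ω → ℕ) (hZ : ∀ i, Measurable (Z i)) (hZ_indep : iIndepFun Z P)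
    (hZ_law : ∀ i, IdentDistrib (Z i) (Z 0) P P)
    (hNZ : IndepFun (fun ω t => N t ω) (fun ω i => Z i ω) P)
    (hZ_pos : 0 < P.real {ω | 1 ≤ Z 0 ω})
    (q : ℝ) (hq0 : 0 < q) (hq1 : q < 1) :
    AEMeasurable (IVS.expFunctional q 0 (IVS.compoundSum N Z)) P ∧
    Summable (fun j : ℕ => IVS.coeff P (Z 0) q j * q ^ j) ∧
    ∑' j : ℕ, IVS.coeff P (Z 0) q j * q ^ j ≠ 0 ∧
    ∀ x : ℝ, 0 < x →
      Summable (fun j : ℕ => IVS.coeff P (Z 0) q j * q ^ j *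
        Real.exp (-(lam : ℝ) * P.real {ω | 1 ≤ Z 0 ω} * q ^ (-(j : ℤ)) * x)) ∧
      P.real {ω | IVS.expFunctional q 0 (IVS.compoundSum N Z) ω ≤ ENNReal.ofReal x} =
        1 - 1 / (∑' j : ℕ, IVS.coeff P (Z 0) q j * q ^ j) *
          ∑' j : ℕ, IVS.coeff P (Z 0) q j * q ^ j *
            Real.exp (-(lam : ℝ) * P.real {ω | 1 ≤ Z 0 ω} * q ^ (-(j : ℤ)) * x) := by
  obtain ⟨N', h, hae⟩ := IVS.exists_isRegularCompound hN hZ hZ_indep hZ_law hNZ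
  have hI : ∀ᵐ ω ∂P, IVS.expFunctional q 0 (IVS.compoundSum N Z) ω =
      IVS.expFunctional q 0 (IVS.compoundSum N' Z) ω := hae.mono fun ω hω => by
    simp only [IVS.expFunctional, IVS.compoundSum, hω]
  have ha : ∀ k, 0 ≤ if k = 0 then 0 else P.real {ω | Z 0 ω = k} := fun k => by
    split_ifs
    exacts [le_rfl, measureReal_nonneg]
  have hap := IVS.hasSum_prob_pos (P := P) (hZ 0)
  have hrec := IVS.coeff_mul_pow_recurrence P (Z 0) hq0 hq1 hZ_pos
  have hds := IVS.summable_of_recurrence hq0 hq1 hZ_pos ha (if_pos rfl) hap hrec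
  have hD := IVS.tsum_pos_of_recurrence hq0 hq1 hZ_pos ha (if_pos rfl) hap
    (by simp [IVS.coeff_zero]) hrec
  refine ⟨?_, hds, hD.ne', fun x hx => ?_⟩
  · have hm : Measurable (IVS.expFunctional q 0 (IVS.compoundSum N' Z)) := by
      rw [funext fun ω => IVS.expFunctional_zero_eq hq0.le (IVS.compoundSum N' Z) ω]
      exact (h.measurable_pow_compoundSum _).lintegral_prod_left'
    exact ⟨_, hm, hI⟩
  have hexp : ∀ j : ℕ, Real.exp (-(lam : ℝ) * P.real {ω | 1 ≤ Z 0 ω} * q ^ (-(j : ℤ)) * x) =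
      Real.exp (-(lam * P.real {ω | 1 ≤ Z 0 ω} / q ^ j * x)) := fun j => by
    rw [zpow_neg, zpow_natCast]
    ring_nf
  simp_rw [hexp]
  refine ⟨hds.abs.of_norm_bounded fun j => ?_, ?_⟩
  · rw [norm_mul, Real.norm_of_nonneg (Real.exp_pos _).le]
    exact mul_le_of_le_one_right (norm_nonneg _)
      (Real.exp_le_one_iff.2 (neg_nonpos.2 (by positivity)))
  · have hset : P.real {ω | IVS.expFunctional q 0 (IVS.compoundSum N Z) ω ≤ ENNReal.ofReal x} =
        P.real {ω | IVS.expFunctional q 0 (IVS.compoundSum N' Z) ω ≤ ENNReal.ofReal x} := by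
      refine measureReal_congr (hI.mono fun ω hω => propext ?_)
      change _ ≤ ENNReal.ofReal x ↔ _ ≤ ENNReal.ofReal x
      rw [hω]
    rw [hset, ← h.mul_tail_expFunctional hlam hZ_pos hq0 hq1 hx.le, ← mul_assoc,
      one_div_mul_cancel hD.ne', one_mul, sub_sub_cancel]
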